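/- Let $k$ be an algebraically closed field of characteristic $0$, let $n\ge 0$, and let $S=k[x_0,\dots,x_n]$ with its standard grading and partial derivatives $\partial_i=\partial/\partial x_i$. **Notation.** Let $\mathfrak g_2$ be the free $2$-step nilpotent Lie algebra on $x_0,\dots,x_n$ (the free Lie algebra $L$ modulo $[L,[L,L]]$), with basis $\mathbf z$ consisting of $x_0,\dots,x_n$ followed by the $y_{ij}=[x_i,x_j]$, $i<j$; put $e(x_i)=1$, $e(y_{ij})=2$. Let $S_2=\mathcal U(\mathfrak g_2)$, identified as a vector space with $k[\mathbf z]$ through ordered monomials, so that $S_2=\bigoplus_m S\otimes R_2^m\langle\mathbf y\rangle$, where $S\otimes R_2^m\langle\mathbf y\rangle=\bigoplus_{\deg \mathbf y^\alpha=m}S\,\mathbf y^\alpha$ with $\deg y_{ij}=2$. Each $S\otimes R_2^m\langle\mathbf y\rangle$ is an $S$-module and, with the componentwise multiplication, a commutative graded algebra. For an element $z_j$ of the basis and an integer $l\ge 0$ let $$\Delta_{j,l}=\sum_{|\mathbf i_x|=l,\ |\mathbf i|_j>0}R\big(\mathrm{ad}(\overline{\mathbf z})^{\mathbf i}(z_j)\big)\overline\partial^{\,\mathbf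 i},\qquad \nabla_{j,l}=-\sum_{|\mathbf i_x|=l,\ |\mathbf i|_j=0,\ \mathbf i\ne 0}R\big(\mathrm{ad}(\overline{\mathbf z})^{\mathbf i}(z_j)\big)\overline\partial^{\,\mathbf i}$$ on $S_2$, where $\mathbf i$ runs over multi-indices for $\mathbf z$, $|\mathbf i_x|$ is the part of its degree in the $x$-variables, $|\mathbf i|_j$ is the sum of its entries up to the index $j$, $R(a)$ is the right multiplication by $a$, $\mathrm{ad}(\overline{\mathbf z})^{\mathbf i}=\mathrm{ad}(z_v)^{i_v}\cdots\mathrm{ad}(z_0)^{i_0}$ ($z_0,\dots,z_v$ being the elements of $\mathbf z$ in order), and $\overline\partial^{\,\mathbf i}=\frac{(-1)^{|\mathbf i|}}{\mathbf i!}\partial_{\mathbf z}^{\mathbf i}$ is taken in $k[\mathbf z]$. (Explicitly, the only nonzero ones are $\Delta_{j,1}=-\sum_{i<j}\partial_i y_{ij}$ and $\nabla_{j,1}=-\sum_{i>j}\partial_i y_{ji}$ for $z_j=x_j$.) A *differential chain* in $S_2$ is a family of graded $S$-submodules $I_m\subseteq S\otimes R_2^m\langle\mathbf y\rangle$, $m\ge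 0$, such that $y_{ij}I_m\subseteq I_{m+2}$ for all $i<j$ (commutative multiplication in $k[\mathbf z]$) and $\Delta_{j,l}(I_m)+\nabla_{j,l}(I_m)\subseteq I_{m+e(z_j)+l}$ for all $m$, all $z_j$ and all $0\le l\le 2-e(z_j)$. Put $N_m=(S\otimes R_2^m\langle\mathbf y\rangle)/I_m$. A *geometric quantization* in $\mathbb P^n_{k,2}$ of $Y=\operatorname{Proj}(S/I_0)\subseteq\mathbb P^n_k$ is the pair $(Y,\mathcal O_{2,Y})$, $\mathcal O_{2,Y}=\prod_{m\ge 0}\widetilde{N_m}(-m)$, given by a differential chain which starts with the graded ideal $I_0$ and in which every $I_m$ is an ideal of the commutative algebra $S\otimes R_2^m\langle\mathbf y\rangle$. It is *infinite* if infinitely many of the factors $\widetilde{N_m}(-m)$ are nonzero. **Proposition.** Let $Y\subseteq\mathbb P^n_k$ be the projective scheme given by a graded ideal $I_0\subseteq S$. Then $Y$ admits an infinite geometric quantization in $\mathbb P^n_{k,2}$ if and only if there exist indices $0\le i<j\le n$ and a proper graded ideal $J\subsetneq S$ such that $\partial_i(J)\subseteq J$, $\partial_j(J)\subseteq J$ and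 $I_0+\partial_i(I_0)+\partial_j(I_0)\subseteq J$. -/

import Mathlib

noncomputable section

namespace GeomQuant

open MvPolynomial

universe u

/-! ## The free nilpotent Lie algebra of index `2` and its enveloping algebra -/

/-- The graded polynomial algebra `S = k[x₀, …, xₙ]`. -/
abbrev S (k : Type u) [Field k] (n : ℕ) : Type u := MvPolynomial (Fin (n + 1)) k

/-- The standard grading `S = ⨁ Sᵈ`. -/
abbrev grading (k : Type u) [Field k] (n : ℕ) : ℕ → Submodule k (S k n) :=
  homogeneousSubmodule (Fin (n + 1)) k

instance gradingGradedAlgebra (k : Type u) [Field k] (n : ℕ) : GradedAlgebra (grading k n) :=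
  MvPolynomial.gradedAlgebra

/-- Indices `(i, j)` with `i < j` of the radical variables `y_{ij} = [x_i, x_j]`. -/
abbrev YIdx (n : ℕ) : Type := {p : Fin (n + 1) × Fin (n + 1) // p.1 < p.2}

/-- Indices of the whole basis `z = x ⊔ y`. -/
abbrev ZIdx (n : ℕ) : Type := Fin (n + 1) ⊕ YIdx n

/-- `g₂(x)`: the free Lie algebra on `x₀, …, xₙ` modulo `L⁽³⁾ = [L, [L, L]]`.
Mathlib's `lowerCentralSeries` starts with `L` at the index `0`. -/
abbrev g2 (k : Type u) [Field k] (n : ℕ) : Type u :=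
  FreeLieAlgebra k (Fin (n + 1)) ⧸
    (LieModule.lowerCentralSeries k (FreeLieAlgebra k (Fin (n + 1)))
      (FreeLieAlgebra k (Fin (n + 1))) 2)

/-- `S₂`, the universal enveloping algebra of `g₂(x)`. -/
abbrev S2 (k : Type u) [Field k] (n : ℕ) : Type u := UniversalEnvelopingAlgebra k (g2 k n)

/-- The generator `x_i` of `g₂(x)`. -/
def xLie (k : Type u) [Field k] (n : ℕ) (i : Fin (n + 1)) : g2 k n :=
  LieSubmodule.Quotient.mk (FreeLieAlgebra.of k i)

/-- The basis `z` of `g₂(x)`: the variables `x_i` and the commutators `y_{ij} = [x_i, x_j]`,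
`i < j`. -/
def zLie (k : Type u) [Field k] (n : ℕ) : ZIdx n → g2 k n
  | Sum.inl i => xLie k n i
  | Sum.inr p => ⁅xLie k n p.1.1, xLie k n p.1.2⁆

/-- The degrees `e_j`: `1` for the `x_i` and `2` for the `y_{ij}`. -/
def zDeg {n : ℕ} : ZIdx n → ℕ
  | Sum.inl _ => 1
  | Sum.inr _ => 2

/-- The indices of the `y_{ij}` in lexicographic order. -/
def yList (n : ℕ) : List (YIdx n) :=
  (List.finRange (n + 1)).flatMap fun i =>
    (List.finRange (n + 1)).filterMap fun j => if h : i < j then some ⟨(i, j), h⟩ else none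

/-- The indices of the basis `z` in their order: first `x₀, …, xₙ`, then the `y_{ij}`. -/
def zList (n : ℕ) : List (ZIdx n) :=
  (List.finRange (n + 1)).map Sum.inl ++ (yList n).map Sum.inr

/-- The commutative polynomial algebra `k[z]`. -/
abbrev Kz (k : Type u) [Field k] (n : ℕ) : Type u := MvPolynomial (ZIdx n) k

/-- The ordered monomial `z^γ` in `S₂`. -/
def ordMonomial (k : Type u) [Field k] (n : ℕ) (γ : ZIdx n →₀ ℕ) : S2 k n :=
  ((zList n).map fun u => UniversalEnvelopingAlgebra.ι k (zLie k n u) ^ γ u).prod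

/-- The ordered functional calculus `k[z] → S₂`, `p ↦ p(z)`, the linear map which sends a
commutative monomial to the ordered one. It identifies `k[z]` with `S₂` as vector spaces. -/
def ord (k : Type u) [Field k] (n : ℕ) : Kz k n →ₗ[k] S2 k n :=
  (basisMonomials (ZIdx n) k).constr k (ordMonomial k n)

/-! ## The differential operators -/

/-- `∂̄^i p = (-1)^{|i|} / i! · ∂_z^i p`. -/
def dbar {k : Type u} [Field k] {n : ℕ} (i : ZIdx n →₀ ℕ) (p : Kz k n) : Kz k n :=
  ((-1 : k) ^ (∑ u, i u) / ((∏ u, (i u).factorial : ℕ) : k)) •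
    (zList n).foldr (fun u f => (fun g => pderiv u g)^[i u] f) p

/-- `ad(z̄)^i (a) = ad(z_v)^{i_v} ⋯ ad(z_0)^{i_0} (a)` in `g₂(x)`. -/
def adBar {k : Type u} [Field k] {n : ℕ} (i : ZIdx n →₀ ℕ) (a : g2 k n) : g2 k n :=
  (zList n).foldl (fun b u => (fun c => ⁅zLie k n u, c⁆)^[i u] b) a

/-- `|i|_j = i_0 + ⋯ + i_j`. -/
def partialDegree {n : ℕ} (i : ZIdx n →₀ ℕ) (j : ZIdx n) : ℕ :=
  ∑ u with (zList n).idxOf u ≤ (zList n).idxOf j, i u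

/-- `|i_x| = l`: the total degree of `i` in the variables `x` is `l`. -/
def xDegree {n : ℕ} (i : ZIdx n →₀ ℕ) : ℕ := ∑ a : Fin (n + 1), i (Sum.inl a)

/-- `Δ_{j,l} = ∑_{|i_x| = l, |i|_j > 0} R(ad(z̄)^i (z_j)) ∂̄^i`, as an operator on `k[z] = S₂` with
values in `S₂`. For a given `p` only finitely many summands are nonzero. -/
def Delta {k : Type u} [Field k] {n : ℕ} (j : ZIdx n) (l : ℕ) (p : Kz k n) : S2 k n :=
  ∑ᶠ i ∈ {i : ZIdx n →₀ ℕ | xDegree i = l ∧ 0 < partialDegree i j},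
    ord k n (dbar i p) * UniversalEnvelopingAlgebra.ι k (adBar i (zLie k n j))

/-- `∇_{j,l} = -∑_{|i_x| = l, |i|_j = 0, i ≠ 0} R(ad(z̄)^i (z_j)) ∂̄^i`, as an operator on
`k[z] = S₂` with values in `S₂`. -/
def Nabla {k : Type u} [Field k] {n : ℕ} (j : ZIdx n) (l : ℕ) (p : Kz k n) : S2 k n :=
  -∑ᶠ i ∈ {i : ZIdx n →₀ ℕ | xDegree i = l ∧ partialDegree i j = 0 ∧ i ≠ 0},
    ord k n (dbar i p) * UniversalEnvelopingAlgebra.ι k (adBar i (zLie k n j))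

/-! ## Differential chains -/

/-- The exponents `α` with `⟨α⟩ = deg y^α = m`; every `y_{ij}` has degree `2`. -/
abbrev YMon (n m : ℕ) : Type := {α : YIdx n → ℕ // 2 * ∑ p, α p = m}

instance finiteYMon (n m : ℕ) : Finite (YMon n m) := by
  have h : ({α : YIdx n → ℕ | 2 * ∑ p, α p = m}).Finite := by
    refine (Set.finite_Icc (0 : YIdx n → ℕ) (fun _ => m)).subset ?_
    intro α hα
    refine ⟨fun p => Nat.zero_le _, fun p => ?_⟩
    have h1 : α p ≤ ∑ q, α q :=
      Finset.single_le_sum (f := α) (fun _ _ => Nat.zero_le _) (Finset.mem_univ p)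
    have h2 : 2 * ∑ q, α q = m := hα
    show α p ≤ m
    omega
  exact h.to_subtype

instance fintypeYMon (n m : ℕ) : Fintype (YMon n m) := Fintype.ofFinite _

/-- `S ⊗ R₂ᵐ⟨y⟩ = ⨁_{⟨α⟩ = m} S y^α`, with the componentwise multiplication, as a commutative ring
and as an `S`-module along the diagonal map. -/
abbrev SR (k : Type u) [Field k] (n m : ℕ) : Type u := YMon n m → S k n

/-- The inclusion `S ⊗ R₂ᵐ⟨y⟩ ⊆ k[z]`, `(f_α) ↦ ∑ f_α(x) y^α`. -/
def toKz {k : Type u} [Field k] {n m : ℕ} (f : SR k n m) : Kz k n :=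
  ∑ α : YMon n m, rename Sum.inl (f α) * ∏ p : YIdx n, X (Sum.inr p) ^ α.1 p

/-- A differential chain in `S₂`: graded `S`-submodules `I_m ⊆ S ⊗ R₂ᵐ⟨y⟩` with
`z_j (I_m) ⊆ I_{m + e_j}` for every radical variable `z_j`, and
`Δ_{j,l}(I_m) + ∇_{j,l}(I_m) ⊆ I_{m + e_j + l}` for all `j` and `0 ≤ l ≤ 2 - e_j`. -/
structure DifferentialChain (k : Type u) [Field k] (n : ℕ) where
  I : ∀ m : ℕ, Submodule (S k n) (SR k n m)
  graded : ∀ m, ∀ f ∈ I m, ∀ d : ℕ, (fun α => homogeneousComponent d (f α)) ∈ I m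
  chain : ∀ m, ∀ p : YIdx n, ∀ f ∈ I m,
    ∃ g ∈ I (m + zDeg (Sum.inr p : ZIdx n)), X (Sum.inr p) * toKz f = toKz g
  delta : ∀ m, ∀ j : ZIdx n, ∀ l : ℕ, zDeg j + l ≤ 2 → ∀ f ∈ I m,
    ∃ g ∈ I (m + zDeg j + l), Delta j l (toKz f) = ord k n (toKz g)
  nabla : ∀ m, ∀ j : ZIdx n, ∀ l : ℕ, zDeg j + l ≤ 2 → ∀ f ∈ I m,
    ∃ g ∈ I (m + zDeg j + l), Nabla j l (toKz f) = ord k n (toKz g)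

namespace DifferentialChain

variable {k : Type u} [Field k] {n : ℕ}

/-- `I₀` as an ideal of `S = S ⊗ R₂⁰⟨y⟩`. -/
def baseIdeal (C : DifferentialChain k n) : Ideal (S k n) :=
  (C.I 0).comap (Algebra.linearMap (S k n) (SR k n 0))

/-- Every `I_m` is an ideal of the commutative algebra `S ⊗ R₂ᵐ⟨y⟩`. -/
def IsIdealChain (C : DifferentialChain k n) : Prop :=
  ∀ m, ∀ a : SR k n m, ∀ f ∈ C.I m, a * f ∈ C.I m

/-- The `S`-module `N_m = (S ⊗ R₂ᵐ⟨y⟩) / I_m`. -/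
abbrev N (C : DifferentialChain k n) (m : ℕ) : Type u := SR k n m ⧸ C.I m

/-- The homogeneous component of degree `d` of `N_m`, the image of `Sᵈ ⊗ R₂ᵐ⟨y⟩`. -/
def nDeg (C : DifferentialChain k n) (m d : ℕ) : Set (C.N m) :=
  {a | ∃ f : SR k n m, (∀ α, f α ∈ grading k n d) ∧ Submodule.Quotient.mk f = a}

/-- The stalk at the point `p` of `ℙⁿ = Proj S` of all fractions `a / s` with `a ∈ N_m`,
`s ∉ p`. -/
abbrev Loc (C : DifferentialChain k n) (m : ℕ) (p : ProjectiveSpectrum (grading k n)) : Type u :=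
  LocalizedModule p.asHomogeneousIdeal.toIdeal.primeCompl (C.N m)

/-- Near `x` the family `s` is given by one fraction `a / g`, where `a ∈ N_m` and `g ∈ S` are
homogeneous and `deg a - deg g = -m`. -/
def IsFractionAt (C : DifferentialChain k n) (m : ℕ)
    {U : TopologicalSpace.Opens (ProjectiveSpectrum (grading k n))}
    (s : ∀ p : U, C.Loc m p.1) (x : U) : Prop :=
  ∃ V : TopologicalSpace.Opens (ProjectiveSpectrum (grading k n)), x.1 ∈ V ∧
    ∃ d : ℕ, ∃ a ∈ C.nDeg m d, ∃ g ∈ grading k n (d + m), ∀ p : U, p.1 ∈ V →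
      ∃ hg : g ∈ p.1.asHomogeneousIdeal.toIdeal.primeCompl, s p = LocalizedModule.mk a ⟨g, hg⟩

theorem exists_denominator (m : ℕ) (x : ProjectiveSpectrum (grading k n)) :
    ∃ d : ℕ, ∃ g ∈ grading k n (d + m), g ∉ x.asHomogeneousIdeal.toIdeal := by
  classical
  obtain ⟨f, hf, hfx⟩ : ∃ f, f ∈ HomogeneousIdeal.irrelevant (grading k n) ∧
      f ∉ x.asHomogeneousIdeal := by
    by_contra hc
    push Not at hc
    exact x.not_irrelevant_le fun f hf => hc f hf
  have h : ∃ i, (DirectSum.decompose (grading k n) f i : S k n) ∉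
      x.asHomogeneousIdeal.toIdeal := by
    by_contra hc
    push Not at hc
    apply hfx
    rw [← HomogeneousIdeal.mem_iff, ← DirectSum.sum_support_decompose (grading k n) f]
    exact Ideal.sum_mem _ fun i _ => hc i
  obtain ⟨i, hi⟩ := h
  have hi0 : i ≠ 0 := by
    rintro rfl
    apply hi
    have h0 : GradedRing.proj (grading k n) 0 f = 0 :=
      (HomogeneousIdeal.mem_irrelevant_iff _ f).1 hf
    rw [GradedRing.proj_apply] at h0
    rw [h0]
    exact Ideal.zero_mem _
  have him : m ≤ m * i := Nat.le_mul_of_pos_right m (Nat.pos_of_ne_zero hi0)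
  refine ⟨m * i - m, (DirectSum.decompose (grading k n) f i : S k n) ^ m, ?_, ?_⟩
  · rw [Nat.sub_add_cancel him]
    exact SetLike.pow_mem_graded m (DirectSum.decompose (grading k n) f i).2
  · intro hp
    exact hi (x.isPrime.mem_of_pow_mem m hp)

theorem smul_mem_nDeg (C : DifferentialChain k n) {m d e : ℕ} {g : S k n} {a : C.N m}
    (hg : g ∈ grading k n e) (ha : a ∈ C.nDeg m d) : g • a ∈ C.nDeg m (e + d) := by
  obtain ⟨f, hf, rfl⟩ := ha
  exact ⟨g • f, fun α => SetLike.mul_mem_graded hg (hf α), rfl⟩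

theorem add_mem_nDeg (C : DifferentialChain k n) {m d : ℕ} {a b : C.N m}
    (ha : a ∈ C.nDeg m d) (hb : b ∈ C.nDeg m d) : a + b ∈ C.nDeg m d := by
  obtain ⟨f, hf, rfl⟩ := ha
  obtain ⟨g, hg, rfl⟩ := hb
  exact ⟨f + g, fun α => Submodule.add_mem _ (hf α) (hg α), rfl⟩

/-- The sections over `U` of the direct image on `ℙⁿ` of the twisted sheaf `Ñ_m(-m)`. -/
def twistedSections (C : DifferentialChain k n) (m : ℕ)
    (U : TopologicalSpace.Opens (ProjectiveSpectrum (grading k n))) :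
    AddSubgroup (∀ p : U, C.Loc m p.1) where
  carrier := {s | ∀ x : U, C.IsFractionAt m s x}
  zero_mem' := by
    intro x
    obtain ⟨d, g, hg, hgx⟩ := exists_denominator m x.1
    refine ⟨ProjectiveSpectrum.basicOpen (grading k n) g, hgx, d, 0,
      ⟨0, fun α => Submodule.zero_mem _, rfl⟩, g, hg, fun p hp => ⟨hp, ?_⟩⟩
    exact (LocalizedModule.zero_mk _).symm
  add_mem' := by
    intro s t hs ht x
    obtain ⟨V, hxV, d, a, ha, g, hg, hV⟩ := hs x
    obtain ⟨W, hxW, e, b, hb, h, hh, hW⟩ := ht x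
    refine ⟨V ⊓ W, ⟨hxV, hxW⟩, d + e + m, h • a + g • b, ?_, g * h, ?_, fun p hp => ?_⟩
    · refine C.add_mem_nDeg ?_ ?_
      · have := C.smul_mem_nDeg hh ha
        rwa [show e + m + d = d + e + m by omega] at this
      · have := C.smul_mem_nDeg hg hb
        rwa [show d + m + e = d + e + m by omega] at this
    · have := SetLike.mul_mem_graded hg hh
      rwa [show d + m + (e + m) = d + e + m + m by omega] at this
    · obtain ⟨h1, h2⟩ := hV p hp.1
      obtain ⟨h3, h4⟩ := hW p hp.2
      refine ⟨Submonoid.mul_mem _ h1 h3, ?_⟩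
      rw [Pi.add_apply, h2, h4, LocalizedModule.mk_add_mk]
      rfl
  neg_mem' := by
    intro s hs x
    obtain ⟨V, hxV, d, a, ⟨f, hf, rfl⟩, g, hg, hV⟩ := hs x
    refine ⟨V, hxV, d, _, ⟨-f, fun α => Submodule.neg_mem _ (hf α), rfl⟩, g, hg, fun p hp => ?_⟩
    obtain ⟨h1, h2⟩ := hV p hp
    refine ⟨h1, ?_⟩
    rw [Pi.neg_apply, h2]
    exact LocalizedModule.mk_neg.symm

/-- The sections over `U` of the (direct image on `ℙⁿ` of the) structure sheaf
`𝒪_{2,Y} = ∏_m Ñ_m(-m)` of the chain. -/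
def structureSections (C : DifferentialChain k n)
    (U : TopologicalSpace.Opens (ProjectiveSpectrum (grading k n))) :
    AddSubgroup (∀ m : ℕ, ∀ p : U, C.Loc m p.1) :=
  AddSubgroup.pi Set.univ fun m => C.twistedSections m U

/-- The structure sheaf is an infinite direct product: its `m`-th factor is nonzero for infinitely
many `m`. -/
def IsInfinite (C : DifferentialChain k n) : Prop :=
  {m : ℕ | ∃ U, ∃ s ∈ C.structureSections U, s m ≠ 0}.Infinite

end DifferentialChain

/-- The scheme `Y = Proj (S / I₀)` in `ℙⁿ` admits an infinite geometric quantization in `ℙⁿ_{k,2}`: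
there is a differential chain in `S₂` starting with `I₀` which consists of ideals (so that it
defines a geometric quantization `(Y, 𝒪_{2,Y})` of `Y`), and whose structure sheaf is an infinite
direct product. -/
def AdmitsInfiniteGeometricQuantization {k : Type u} [Field k] {n : ℕ} (I₀ : Ideal (S k n)) :
    Prop :=
  ∃ C : DifferentialChain k n, C.baseIdeal = I₀ ∧ C.IsIdealChain ∧ C.IsInfinite

end GeomQuant

end

noncomputable section

namespace GeomQuant

open MvPolynomial

universe u

attribute [local instance] LieRing.ofAssociativeRing

variable {k : Type u} [Field k] {n : ℕ}

/-! ## Ordered monomials are linearly independent -/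

/-! For an exponent `α` let `J_α` be the ideal of all `f` with `f y^α ∈ I_m`. If `I_m` is an ideal
of the componentwise algebra, multiplying by the idempotents of the factors gives `I_m = ⨁ J_α y^α`.
Applied to `f y^α`, the operators `Δ_{x_j,1}` and `∇_{x_i,1}` give sums of terms `-∂_i f · y_{ij}
y^α` and `-∂_j f · y_{ij} y^α` over distinct monomials. So an ideal chain is a family of graded
ideals such that `J_α`, `∂_i J_α`, `∂_j J_α` lie in `J_{α+e_p}` for every `p = (i,j)`
(`derivLE_coeffIdeal`, `chainOfIdeals`).

From a quantization to `J`: the `J_α` increase with `α`. If every `p` had some `t_p` with `J_{t_p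
e_p} = S`, every `α` with `|α|` large would dominate one of the `t_p e_p`, so `N_m = 0` for large
`m`. Hence an infinite quantization has a ray `t ↦ t e_p` of proper ideals
(`exists_coeffIdeal_ne_top`), and their union is the required `J` (`exists_ideal`).

From `J` to a quantization: take `I₀` at the origin, `J` on the rest of one ray and `S` elsewhere
(`admits_of_ideal`). In characteristic zero a proper `∂_i`-stable ideal contains no power of `x_i`,
so the sections `1 / x_i^m` do not vanish.

The chain conditions are equations in `S₂`, while the ideals live in `k[z]`. Recovering coefficients
therefore needs the independence half of the PBW theorem, `ord_injective`. It follows from an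
explicit action of `S₂` on `k[z]`: `x_i` acts by `x_i - ∑_{a<i} y_{ai} ∂_a` and `y_p` by
multiplication, so that an ordered monomial sends `1` to the commutative monomial. -/

/-- The variable `y_{ab}`, understood as `0` unless `a < b`. -/
def yVar (k : Type u) [Field k] {n : ℕ} (a b : Fin (n + 1)) : Kz k n :=
  if h : a < b then X (Sum.inr ⟨(a, b), h⟩) else 0

/-- The derivation `∑_{a < i} y_{ai} ∂_a` of `k[z]`. -/
def yDer (k : Type u) [Field k] {n : ℕ} (i : Fin (n + 1)) : Derivation k (Kz k n) (Kz k n) :=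
  mkDerivation k (Sum.elim (fun a => yVar k a i) fun _ => 0)

theorem yDer_inl (i a : Fin (n + 1)) : yDer k i (X (Sum.inl a)) = yVar k a i := by
  simp [yDer, mkDerivation_X]

theorem yDer_inr (i : Fin (n + 1)) (p : YIdx n) : yDer k i (X (Sum.inr p)) = 0 := by
  simp [yDer, mkDerivation_X]

theorem yDer_yVar (i a b : Fin (n + 1)) : yDer k i (yVar k a b) = 0 := by
  unfold yVar
  split_ifs
  · exact yDer_inr _ _
  · exact map_zero _

/-- The commutator is again a derivation, and it kills every variable because both derivations send
variables to elements annihilated by the other. -/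
theorem yDer_comm (i j : Fin (n + 1)) (P : Kz k n) :
    yDer k i (yDer k j P) = yDer k j (yDer k i P) := by
  have h : ⁅yDer k i, yDer k j⁆ = (0 : Derivation k (Kz k n) (Kz k n)) := by
    refine derivation_ext fun u => ?_
    rcases u with a | p
    · simp [Derivation.commutator_apply, yDer_inl, yDer_yVar]
    · simp [Derivation.commutator_apply, yDer_inr]
  have := congrArg (fun D => D P) h
  simpa [Derivation.commutator_apply, sub_eq_zero] using this

/-- Left multiplication by `x_i` on `S₂`, transported to `k[z]`. -/
def xOp (k : Type u) [Field k] {n : ℕ} (i : Fin (n + 1)) : Module.End k (Kz k n) :=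
  LinearMap.mulLeft k (X (Sum.inl i)) - (yDer k i : Kz k n →ₗ[k] Kz k n)

/-- Left multiplication by `y_p` on `S₂`, transported to `k[z]`. -/
def yOp (k : Type u) [Field k] {n : ℕ} (p : YIdx n) : Module.End k (Kz k n) :=
  LinearMap.mulLeft k (X (Sum.inr p))

theorem xOp_apply (i : Fin (n + 1)) (P : Kz k n) :
    xOp k i P = X (Sum.inl i) * P - yDer k i P := rfl

theorem yOp_apply (p : YIdx n) (P : Kz k n) : yOp k p P = X (Sum.inr p) * P := rfl

/-- Multiplications commute and so do the derivations; only the cross terms `yDer j x_i - yDer i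
x_j` remain. At most one of the two `y`'s is nonzero, so all orders of `i` and `j` are covered. -/
theorem xOp_lie_xOp (i j : Fin (n + 1)) :
    ⁅xOp k i, xOp k j⁆ = LinearMap.mulLeft k (yVar k i j - yVar k j i) := by
  refine LinearMap.ext fun P => ?_
  simp only [LieRing.of_associative_ring_bracket, LinearMap.sub_apply, Module.End.mul_apply,
    xOp_apply, map_sub, Derivation.leibniz, yDer_inl, smul_eq_mul, LinearMap.mulLeft_apply,
    yDer_comm i j P]
  ring

theorem xOp_lie_yOp (i : Fin (n + 1)) (p : YIdx n) : ⁅xOp k i, yOp k p⁆ = 0 := by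
  refine LinearMap.ext fun P => ?_
  simp only [LieRing.of_associative_ring_bracket, LinearMap.sub_apply, Module.End.mul_apply,
    xOp_apply, yOp_apply, Derivation.leibniz, yDer_inr, smul_eq_mul, LinearMap.zero_apply]
  ring

theorem yOp_lie_yOp (p q : YIdx n) : ⁅yOp k p, yOp k q⁆ = 0 := by
  refine LinearMap.ext fun P => ?_
  simp only [LieRing.of_associative_ring_bracket, LinearMap.sub_apply, Module.End.mul_apply,
    yOp_apply, LinearMap.zero_apply]
  ring

theorem mulLeft_yVar_mem (i j : Fin (n + 1)) :
    LinearMap.mulLeft k (yVar k i j) ∈ Submodule.span k (Set.range (yOp k (n := n))) := by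
  unfold yVar
  split_ifs with h
  · exact Submodule.subset_span ⟨_, rfl⟩
  · rw [LinearMap.mulLeft_zero_eq_zero]
    exact Submodule.zero_mem _

/-- The span of the operators `xOp` and `yOp`. -/
def opSpan (k : Type u) [Field k] (n : ℕ) : Submodule k (Module.End k (Kz k n)) :=
  Submodule.span k (Set.range (xOp k) ∪ Set.range (yOp k))

theorem lie_mem_span_yOp {f g : Module.End k (Kz k n)} (hf : f ∈ opSpan k n)
    (hg : g ∈ opSpan k n) : ⁅f, g⁆ ∈ Submodule.span k (Set.range (yOp k (n := n))) := by
  induction hf using Submodule.span_induction with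
  | zero => rw [zero_lie]; exact Submodule.zero_mem _
  | add a b _ _ ha hb => rw [add_lie]; exact Submodule.add_mem _ ha hb
  | smul c a _ ha => rw [smul_lie]; exact Submodule.smul_mem _ c ha
  | mem a ha =>
    induction hg using Submodule.span_induction with
    | zero => rw [lie_zero]; exact Submodule.zero_mem _
    | add b c _ _ hb hc => rw [lie_add]; exact Submodule.add_mem _ hb hc
    | smul c b _ hb => rw [lie_smul]; exact Submodule.smul_mem _ c hb
    | mem b hb =>
      rcases ha with ⟨i, rfl⟩ | ⟨p, rfl⟩ <;> rcases hb with ⟨j, rfl⟩ | ⟨q, rfl⟩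
      · rw [xOp_lie_xOp]
        have : LinearMap.mulLeft k (yVar k i j - yVar k j i) =
            LinearMap.mulLeft k (yVar k i j) - LinearMap.mulLeft k (yVar k j i) := by
          refine LinearMap.ext fun P => ?_
          exact sub_mul _ _ _
        rw [this]
        exact Submodule.sub_mem _ (mulLeft_yVar_mem _ _) (mulLeft_yVar_mem _ _)
      · rw [xOp_lie_yOp]
        exact Submodule.zero_mem _
      · rw [← lie_skew, xOp_lie_yOp, neg_zero]
        exact Submodule.zero_mem _
      · rw [yOp_lie_yOp]
        exact Submodule.zero_mem _

theorem lie_eq_zero_of_mem_span_yOp {f g : Module.End k (Kz k n)} (hf : f ∈ opSpan k n)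
    (hg : g ∈ Submodule.span k (Set.range (yOp k (n := n)))) : ⁅f, g⁆ = 0 := by
  induction hf using Submodule.span_induction with
  | zero => exact zero_lie _
  | add a b _ _ ha hb => rw [add_lie, ha, hb, add_zero]
  | smul c a _ ha => rw [smul_lie, ha, smul_zero]
  | mem a ha =>
    induction hg using Submodule.span_induction with
    | zero => exact lie_zero _
    | add b c _ _ hb hc => rw [lie_add, hb, hc, add_zero]
    | smul c b _ hb => rw [lie_smul, hb, smul_zero]
    | mem b hb =>
      obtain ⟨q, rfl⟩ := hb
      rcases ha with ⟨i, rfl⟩ | ⟨p, rfl⟩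
      · exact xOp_lie_yOp _ _
      · exact yOp_lie_yOp _ _

/-- `opSpan` as a Lie algebra of operators. -/
def opLie (k : Type u) [Field k] (n : ℕ) : LieSubalgebra k (Module.End k (Kz k n)) where
  toSubmodule := opSpan k n
  lie_mem' := fun hf hg =>
    Submodule.span_mono Set.subset_union_right (lie_mem_span_yOp hf hg)

theorem xOp_mem_opLie (i : Fin (n + 1)) : xOp k i ∈ opLie k n :=
  Submodule.subset_span (Or.inl ⟨i, rfl⟩)

/-- The action of the free Lie algebra on `k[z]`. -/
def freeRep (k : Type u) [Field k] (n : ℕ) : FreeLieAlgebra k (Fin (n + 1)) →ₗ⁅k⁆ opLie k n :=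
  FreeLieAlgebra.lift k fun i => ⟨xOp k i, xOp_mem_opLie i⟩

/-- Brackets of operators are combinations of the `yOp`, which are central in `opLie`. So the
operators are 2-step nilpotent and the action descends to `g₂`. -/
theorem freeRep_eq_zero (a : FreeLieAlgebra k (Fin (n + 1)))
    (ha : a ∈ LieModule.lowerCentralSeries k (FreeLieAlgebra k (Fin (n + 1)))
      (FreeLieAlgebra k (Fin (n + 1))) 2) : freeRep k n a = 0 := by
  have h : LieModule.lowerCentralSeries k (FreeLieAlgebra k (Fin (n + 1)))
      (FreeLieAlgebra k (Fin (n + 1))) 2 ≤ (freeRep k n).ker := by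
    have h1 : LieModule.lowerCentralSeries k (FreeLieAlgebra k (Fin (n + 1)))
        (FreeLieAlgebra k (Fin (n + 1))) 1 ≤
        LieIdeal.comap (freeRep k n) (LieAlgebra.center k (opLie k n)) := by
      rw [LieModule.lowerCentralSeries_succ, LieSubmodule.lie_le_iff]
      intro b _ c _
      rw [LieIdeal.mem_comap, LieModule.mem_maxTrivSubmodule]
      intro a
      apply Subtype.ext
      rw [LieHom.map_lie, LieSubalgebra.coe_bracket, LieSubalgebra.coe_bracket]
      exact lie_eq_zero_of_mem_span_yOp a.2
        (lie_mem_span_yOp (freeRep k n b).2 (freeRep k n c).2)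
    rw [LieModule.lowerCentralSeries_succ, LieSubmodule.lie_le_iff]
    intro a _ u hu
    have := (LieModule.mem_maxTrivSubmodule k _ _ _).1 (LieIdeal.mem_comap.1 (h1 hu))
    rw [LieHom.mem_ker, LieHom.map_lie]
    exact this _
  exact (LieHom.mem_ker).1 (h ha)

/-- The action of `g₂` on `k[z]`. -/
def g2Rep (k : Type u) [Field k] (n : ℕ) : g2 k n →ₗ⁅k⁆ Module.End k (Kz k n) :=
  { Submodule.liftQ _ ((opLie k n).incl.comp (freeRep k n)).toLinearMap (fun a ha => by
      rw [LinearMap.mem_ker]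
      exact congrArg Subtype.val (freeRep_eq_zero a ha)) with
    map_lie' := by
      intro x y
      induction x using Submodule.Quotient.induction_on with | _ x =>
      induction y using Submodule.Quotient.induction_on with | _ y =>
      exact ((opLie k n).incl.comp (freeRep k n)).map_lie x y }

theorem g2Rep_xLie (i : Fin (n + 1)) : g2Rep k n (xLie k n i) = xOp k i := by
  have : freeRep k n (FreeLieAlgebra.of k i) = ⟨xOp k i, xOp_mem_opLie i⟩ :=
    FreeLieAlgebra.lift_of_apply _ i
  exact congrArg Subtype.val this

theorem g2Rep_inr (p : YIdx n) : g2Rep k n (zLie k n (Sum.inr p)) = yOp k p := by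
  have h : ¬ p.1.2 < p.1.1 := not_lt.2 p.2.le
  rw [zLie, LieHom.map_lie, g2Rep_xLie, g2Rep_xLie, xOp_lie_xOp]
  simp only [yVar, dif_pos p.2, dif_neg h, sub_zero]
  rfl

/-- The action of `S₂` on `k[z]`. -/
def s2Rep (k : Type u) [Field k] (n : ℕ) : S2 k n →ₐ[k] Module.End k (Kz k n) :=
  UniversalEnvelopingAlgebra.lift k (g2Rep k n)

theorem s2Rep_ι (a : g2 k n) :
    s2Rep k n (UniversalEnvelopingAlgebra.ι k a) = g2Rep k n a :=
  UniversalEnvelopingAlgebra.lift_ι_apply k _ a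

/-! ### Ordered products and their action on `1`. -/

theorem mem_yList (p : YIdx n) : p ∈ yList n := by
  simp only [yList, List.mem_flatMap, List.mem_filterMap, List.mem_finRange, true_and]
  exact ⟨p.1.1, p.1.2, by rw [dif_pos p.2]⟩

theorem nodup_yList (n : ℕ) : (yList n).Nodup := by
  rw [yList, List.nodup_flatMap]
  refine ⟨fun i _ => ?_, ?_⟩
  · refine List.Nodup.filterMap ?_ (List.nodup_finRange _)
    intro a b c ha hb
    simp only [Option.mem_def, Option.dite_none_right_eq_some, Option.some.injEq] at ha hb
    obtain ⟨_, rfl⟩ := ha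
    obtain ⟨_, hb⟩ := hb
    simpa using (congrArg (fun q => q.1.2) hb).symm
  · refine (List.nodup_finRange _).imp ?_
    intro a b hab
    simp only [Function.onFun, List.disjoint_left, List.mem_filterMap]
    rintro c ⟨d, _, hd⟩ ⟨e, _, he⟩
    simp only [Option.dite_none_right_eq_some, Option.some.injEq] at hd he
    obtain ⟨_, rfl⟩ := hd
    obtain ⟨_, he⟩ := he
    exact hab (congrArg (fun q => q.1.1) he).symm

theorem mem_zList (u : ZIdx n) : u ∈ zList n := by
  rcases u with a | p
  · simp [zList]
  · simp [zList, mem_yList]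

theorem nodup_zList (n : ℕ) : (zList n).Nodup := by
  rw [zList, List.nodup_append]
  refine ⟨(List.nodup_finRange _).map Sum.inl_injective,
    (nodup_yList n).map Sum.inr_injective, ?_⟩
  simp

theorem prod_zList {M : Type*} [CommMonoid M] (f : ZIdx n → M) :
    ((zList n).map f).prod = ∏ u, f u := by
  rw [← List.prod_toFinset _ (nodup_zList n)]
  congr 1
  ext u
  simp [mem_zList]

theorem prod_yOp_apply (γ : YIdx n → ℕ) (l : List (YIdx n)) (P : Kz k n) :
    (l.map fun p => yOp k p ^ γ p).prod P =
      (l.map fun p => (X (Sum.inr p) : Kz k n) ^ γ p).prod * P := by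
  induction l with
  | nil => simp
  | cons p l ih =>
    have h (t : ℕ) (Q : Kz k n) : (yOp k p ^ t) Q = X (Sum.inr p) ^ t * Q := by
      induction t with
      | zero => simp
      | succ t iht => rw [pow_succ', Module.End.mul_apply, iht, yOp_apply]; ring
    rw [List.map_cons, List.prod_cons, Module.End.mul_apply, ih, h, List.map_cons,
      List.prod_cons, mul_assoc]

/-- The derivation in `xOp b` differentiates only in the `x_a` with `a < b`, and in an ordered
product only `x_a` with `a ≥ b` stand to its right, so the correction term vanishes. The second
claim is carried along because it is what the next induction step needs. -/
theorem prod_xOp_apply (γ : Fin (n + 1) → ℕ) (l : List (Fin (n + 1)))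
    (hl : l.Pairwise (· < ·)) (P : Kz k n) (hP : ∀ i, yDer k i P = 0) :
    (l.map fun i => xOp k i ^ γ i).prod P =
        (l.map fun i => (X (Sum.inl i) : Kz k n) ^ γ i).prod * P ∧
      ∀ i, (∀ a ∈ l, i ≤ a) →
        yDer k i ((l.map fun i => (X (Sum.inl i) : Kz k n) ^ γ i).prod * P) = 0 := by
  induction l with
  | nil => simpa using hP
  | cons b l ih =>
    rw [List.pairwise_cons] at hl
    obtain ⟨ih1, ih2⟩ := ih hl.2
    have hX (i : Fin (n + 1)) (hi : i ≤ b) : yDer k i (X (Sum.inl b) : Kz k n) = 0 := by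
      rw [yDer_inl, yVar, dif_neg (not_lt.2 hi)]
    have hpow (i : Fin (n + 1)) (hi : i ≤ b) (t : ℕ) :
        yDer k i (X (Sum.inl b) ^ t * ((l.map fun i => (X (Sum.inl i) : Kz k n) ^ γ i).prod * P))
          = 0 := by
      rw [Derivation.leibniz, Derivation.leibniz_pow, hX i hi,
        ih2 i fun a ha => hi.trans (hl.1 a ha).le]
      simp
    have h (t : ℕ) : (xOp k b ^ t) ((l.map fun i => (X (Sum.inl i) : Kz k n) ^ γ i).prod * P) =
        X (Sum.inl b) ^ t * ((l.map fun i => (X (Sum.inl i) : Kz k n) ^ γ i).prod * P) := by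
      induction t with
      | zero => simp
      | succ t iht =>
        rw [pow_succ', Module.End.mul_apply, iht, xOp_apply, hpow b le_rfl]; ring
    simp only [List.map_cons, List.prod_cons, Module.End.mul_apply, mul_assoc]
    rw [ih1]
    exact ⟨h _, fun i hi => hpow i (hi b List.mem_cons_self) _⟩

theorem s2Rep_ordMonomial (γ : ZIdx n →₀ ℕ) :
    s2Rep k n (ordMonomial k n γ) 1 = monomial γ 1 := by
  have hy : ∀ i, yDer k i (((yList n).map fun p => (X (Sum.inr p) : Kz k n) ^ γ (Sum.inr p)).prod)
      = 0 := by
    intro i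
    generalize yList n = l
    induction l with
    | nil => simp
    | cons p l ih =>
      rw [List.map_cons, List.prod_cons, Derivation.leibniz, Derivation.leibniz_pow, ih, yDer_inr]
      simp
  rw [ordMonomial, map_list_prod, List.map_map, zList, List.map_append, List.prod_append,
    List.map_map, List.map_map, Module.End.mul_apply]
  have e1 : ((⇑(s2Rep k n) ∘ fun u => UniversalEnvelopingAlgebra.ι k (zLie k n u) ^ γ u) ∘
      Sum.inr) = fun p => yOp k p ^ γ (Sum.inr p) := by
    funext p
    simp only [Function.comp_apply, map_pow, s2Rep_ι, g2Rep_inr]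
  have e2 : ((⇑(s2Rep k n) ∘ fun u => UniversalEnvelopingAlgebra.ι k (zLie k n u) ^ γ u) ∘
      Sum.inl) = fun i => xOp k i ^ γ (Sum.inl i) := by
    funext p
    simp only [Function.comp_apply, map_pow, s2Rep_ι, zLie, g2Rep_xLie]
  rw [e1, e2, prod_yOp_apply (fun p => γ (Sum.inr p)), mul_one,
    (prod_xOp_apply (fun i => γ (Sum.inl i)) _ (List.pairwise_lt_finRange _) _ hy).1]
  have := prod_zList (n := n) fun u => (X u : Kz k n) ^ γ u
  rw [zList, List.map_append, List.prod_append, List.map_map, List.map_map] at this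
  rw [monomial_eq, map_one, one_mul, Finsupp.prod_fintype _ _ fun _ => pow_zero _]
  exact this

theorem s2Rep_ord (P : Kz k n) : s2Rep k n (ord k n P) 1 = P := by
  have h : (LinearMap.applyₗ (R := k) (1 : Kz k n)) ∘ₗ (s2Rep k n).toLinearMap ∘ₗ ord k n =
      LinearMap.id := by
    refine (basisMonomials (ZIdx n) k).ext fun γ => ?_
    simp only [LinearMap.comp_apply, ord, Module.Basis.constr_basis]
    simpa using s2Rep_ordMonomial γ
  exact congrArg (fun f => f P) h

theorem ord_injective (k : Type u) [Field k] (n : ℕ) : Function.Injective (ord k n) :=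
  fun P Q h => by rw [← s2Rep_ord P, h, s2Rep_ord]

/-! ## The operators `Δ` and `∇` -/

/-- The bracket lifts to a threefold commutator in the free Lie algebra, which is divided out. -/
theorem y_lie (p : YIdx n) (c : g2 k n) : ⁅zLie k n (Sum.inr p), c⁆ = 0 := by
  induction c using Submodule.Quotient.induction_on with | _ c =>
  have h : ⁅⁅FreeLieAlgebra.of k p.1.1, FreeLieAlgebra.of k p.1.2⁆, c⁆ ∈
      LieModule.lowerCentralSeries k (FreeLieAlgebra k (Fin (n + 1)))
        (FreeLieAlgebra k (Fin (n + 1))) 2 := by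
    rw [← lie_skew, neg_mem_iff, LieModule.lowerCentralSeries_succ,
      LieModule.lowerCentralSeries_succ]
    exact LieSubmodule.lie_mem_lie (LieSubmodule.mem_top _)
      (LieSubmodule.lie_mem_lie (LieSubmodule.mem_top _) (LieSubmodule.mem_top _))
  exact (Submodule.Quotient.mk_eq_zero _).2 h

theorem commute_ι_y (p : YIdx n) (c : g2 k n) :
    Commute (UniversalEnvelopingAlgebra.ι k (zLie k n (Sum.inr p)))
      (UniversalEnvelopingAlgebra.ι k c) := by
  have h := (UniversalEnvelopingAlgebra.ι k).map_lie (zLie k n (Sum.inr p)) c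
  rw [y_lie, _root_.map_zero, LieRing.of_associative_ring_bracket] at h
  exact (sub_eq_zero.1 h.symm)

theorem prod_map_pow_add_single {M ι : Type*} [Monoid M] (f : ι → M) (γ : ι →₀ ℕ) (v : ι)
    (hv : ∀ u, Commute (f v) (f u)) (l : List ι) (hl : l.Nodup) (hvl : v ∈ l) :
    (l.map fun u => f u ^ (γ + Finsupp.single v 1 : ι →₀ ℕ) u).prod =
      (l.map fun u => f u ^ γ u).prod * f v := by
  induction l with
  | nil => simp at hvl
  | cons a l ih =>
    rw [List.nodup_cons] at hl
    simp only [List.map_cons, List.prod_cons]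
    by_cases h : a = v
    · subst h
      have h1 : (l.map fun u => f u ^ (γ + Finsupp.single a 1 : ι →₀ ℕ) u) = l.map fun u => f u ^ γ u := by
        refine List.map_congr_left fun u hu => ?_
        have : a ≠ u := fun e => hl.1 (e ▸ hu)
        simp [this]
      have h2 : Commute (f a) (l.map fun u => f u ^ γ u).prod := by
        refine Commute.list_prod_right _ _ fun x hx => ?_
        obtain ⟨u, _, rfl⟩ := List.mem_map.1 hx
        exact (hv u).pow_right _
      rw [h1, Finsupp.add_apply, Finsupp.single_eq_same, pow_succ, mul_assoc, mul_assoc, h2.eq]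
    · have h3 : v ∈ l := (List.mem_cons.1 hvl).resolve_left (Ne.symm h)
      rw [ih hl.2 h3, Finsupp.add_apply, Finsupp.single_eq_of_ne h, add_zero, mul_assoc]

/-- Since `y_p` is central, it can be moved from the far right to its own place in the ordered
monomial. -/
theorem ord_mul_ι_y (P : Kz k n) (p : YIdx n) :
    ord k n P * UniversalEnvelopingAlgebra.ι k (zLie k n (Sum.inr p)) =
      ord k n (X (Sum.inr p) * P) := by
  have h : LinearMap.mulRight k (UniversalEnvelopingAlgebra.ι k (zLie k n (Sum.inr p))) ∘ₗ
      ord k n = ord k n ∘ₗ LinearMap.mulLeft k (X (Sum.inr p)) := by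
    refine (basisMonomials (ZIdx n) k).ext fun γ => ?_
    have e : (X (Sum.inr p) * monomial γ 1 : Kz k n) =
        basisMonomials (ZIdx n) k (γ + Finsupp.single (Sum.inr p) 1) := by
      rw [coe_basisMonomials, X, monomial_mul, add_comm (Finsupp.single _ _), one_mul]
    rw [LinearMap.comp_apply, LinearMap.comp_apply, LinearMap.mulRight_apply,
      LinearMap.mulLeft_apply, show basisMonomials (ZIdx n) k γ = monomial γ 1 from rfl, e,
      show (monomial γ 1 : Kz k n) = basisMonomials (ZIdx n) k γ from rfl, ord,
      Module.Basis.constr_basis, Module.Basis.constr_basis]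
    exact (prod_map_pow_add_single (fun u => UniversalEnvelopingAlgebra.ι k (zLie k n u)) γ
      (Sum.inr p) (fun u => commute_ι_y p _) _ (nodup_zList n) (mem_zList _)).symm
  exact congrArg (fun f => f P) h

/-! ### The surviving summands of `Δ` and `∇`. -/

theorem foldl_iterate_single {ι A : Type*} [DecidableEq ι] (F : ι → A → A) (v : ι) (l : List ι)
    (hl : l.Nodup) (a : A) :
    l.foldl (fun b u => (F u)^[Finsupp.single v 1 u] b) a = if v ∈ l then F v a else a := by
  induction l generalizing a with
  | nil => simp
  | cons w l ih =>
    rw [List.nodup_cons] at hl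
    rw [List.foldl_cons, ih hl.2]
    by_cases h : v = w
    · subst h
      simp [hl.1]
    · simp [h]

theorem foldr_iterate_single {ι A : Type*} [DecidableEq ι] (F : ι → A → A) (v : ι) (l : List ι)
    (hl : l.Nodup) (a : A) :
    l.foldr (fun u b => (F u)^[Finsupp.single v 1 u] b) a = if v ∈ l then F v a else a := by
  rw [← List.foldl_reverse, foldl_iterate_single F v _ (List.nodup_reverse.2 hl)]
  simp

theorem foldl_eq_zero {ι A : Type*} [Zero A] (F : ι → A → A) (v : ι) (hv : ∀ b, F v b = 0)
    (h0 : ∀ u, F u 0 = 0) (l : List ι) (hl : v ∈ l) (a : A) :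
    l.foldl (fun b u => F u b) a = 0 := by
  have hz : ∀ l : List ι, l.foldl (fun b u => F u b) 0 = 0 := by
    intro l
    induction l with
    | nil => rfl
    | cons w l ih => rw [List.foldl_cons, h0, ih]
  induction l generalizing a with
  | nil => simp at hl
  | cons w l ih =>
    rw [List.foldl_cons]
    rcases List.mem_cons.1 hl with h | h
    · rw [← h, hv, hz]
    · exact ih h _

/-- One factor `ad(y_p) = 0` annihilates the whole composite, so only multi-indices purely in the
`x`-variables contribute. -/
theorem adBar_eq_zero (i : ZIdx n →₀ ℕ) (p : YIdx n) (hp : i (Sum.inr p) ≠ 0) (a : g2 k n) :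
    adBar i a = 0 := by
  refine foldl_eq_zero (fun u => (fun c => ⁅zLie k n u, c⁆)^[i u]) (Sum.inr p) ?_ ?_ _
    (mem_zList _) a
  · intro b
    obtain ⟨t, ht⟩ := Nat.exists_eq_succ_of_ne_zero hp
    rw [ht, Function.iterate_succ_apply']
    exact y_lie _ _
  · intro u
    exact Function.iterate_fixed (lie_zero (zLie k n u)) _

theorem adBar_single (u : ZIdx n) (a : g2 k n) :
    adBar (Finsupp.single u 1) a = ⁅zLie k n u, a⁆ := by
  classical
  exact (foldl_iterate_single (fun u c => ⁅zLie k n u, c⁆) u _ (nodup_zList n) a).trans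
    (if_pos (mem_zList u))

theorem dbar_single (u : ZIdx n) (P : Kz k n) :
    dbar (Finsupp.single u 1) P = -pderiv u P := by
  classical
  have h := (foldr_iterate_single (fun u g => pderiv (R := k) u g) u _ (nodup_zList n) P).trans
    (if_pos (mem_zList u))
  have h1 : ∑ v, (Finsupp.single u 1 : ZIdx n →₀ ℕ) v = 1 := by
    simp [Finsupp.single_apply]
  have h2 : ∏ v, ((Finsupp.single u 1 : ZIdx n →₀ ℕ) v).factorial = 1 := by
    refine Finset.prod_eq_one fun v _ => ?_
    rw [Finsupp.single_apply]
    split_ifs <;> rfl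
  unfold dbar
  rw [h, h1, h2]
  simp

theorem exists_inr_ne_zero {i : ZIdx n →₀ ℕ} (h : xDegree i = 0) (hi : i ≠ 0) :
    ∃ p, i (Sum.inr p) ≠ 0 := by
  by_contra hc
  push Not at hc
  refine hi (Finsupp.ext fun u => ?_)
  rcases u with a | p
  · exact (Finset.sum_eq_zero_iff.1 h) a (Finset.mem_univ a)
  · exact hc p

theorem eq_single_of_xDegree_eq_one {i : ZIdx n →₀ ℕ} (h : xDegree i = 1)
    (hi : ∀ p, i (Sum.inr p) = 0) : ∃ a : Fin (n + 1), i = Finsupp.single (Sum.inl a) 1 := by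
  obtain ⟨a, ha⟩ : ∃ a : Fin (n + 1), i (Sum.inl a) ≠ 0 := by
    by_contra hc
    push Not at hc
    rw [xDegree, Finset.sum_eq_zero fun a _ => hc a] at h
    exact zero_ne_one h
  have hs := Finset.add_sum_erase Finset.univ (fun a => i (Sum.inl a)) (Finset.mem_univ a)
  have h' : ∑ a : Fin (n + 1), i (Sum.inl a) = 1 := h
  have ha1 : i (Sum.inl a) = 1 := by omega
  have h0 : ∑ b ∈ Finset.univ.erase a, i (Sum.inl b) = 0 := by omega
  refine ⟨a, Finsupp.ext fun u => ?_⟩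
  rcases u with b | p
  · by_cases hb : b = a
    · rw [hb, ha1, Finsupp.single_eq_same]
    · rw [Finsupp.single_eq_of_ne (by simpa using hb)]
      exact Finset.sum_eq_zero_iff.1 h0 b (Finset.mem_erase.2 ⟨hb, Finset.mem_univ b⟩)
  · rw [hi, Finsupp.single_eq_of_ne (by simp)]

theorem xDegree_single (a : Fin (n + 1)) :
    xDegree (Finsupp.single (Sum.inl a : ZIdx n) 1) = 1 := by
  simp [xDegree, Finsupp.single_apply]

/-- `partialDegree` compares positions through `List.idxOf`, which uses Boolean equality; computing
positions requires it to be lawful. -/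
instance lawfulBEqZIdx (n : ℕ) : LawfulBEq (ZIdx n) where
  eq_of_beq {a b} h := by
    rcases a with a | p <;> rcases b with b | q
    · exact congrArg Sum.inl (eq_of_beq (show (a == b) = true from h))
    · exact absurd h Bool.false_ne_true
    · exact absurd h Bool.false_ne_true
    · exact congrArg Sum.inr (eq_of_beq (show (p == q) = true from h))
  rfl {a} := by
    rcases a with a | p
    · exact beq_self_eq_true a
    · exact beq_self_eq_true p

theorem idxOf_zList (a : Fin (n + 1)) : (zList n).idxOf (Sum.inl a) = a := by
  have h : ((List.finRange (n + 1)).map (Sum.inl : _ → ZIdx n))[(a : ℕ)]'(by simpa using a.is_lt) =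
      Sum.inl a := by simp
  rw [zList, List.idxOf_append_of_mem (by simp)]
  conv_lhs => rw [← h]
  exact ((List.nodup_finRange _).map Sum.inl_injective).idxOf_getElem _ _

theorem partialDegree_single (a j : Fin (n + 1)) :
    partialDegree (Finsupp.single (Sum.inl a : ZIdx n) 1) (Sum.inl j) = if a ≤ j then 1 else 0 := by
  rw [partialDegree, Finset.sum_filter]
  simp only [Finsupp.single_apply]
  rw [Finset.sum_eq_single (Sum.inl a)]
  · simp [idxOf_zList]
  · intro b _ hb
    simp [Ne.symm hb]
  · simp

theorem finsum_mem_xDegree_zero (s : Set (ZIdx n →₀ ℕ)) (hs : ∀ i ∈ s, xDegree i = 0 ∧ i ≠ 0)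
    (a : g2 k n) (P : Kz k n) :
    ∑ᶠ i ∈ s, ord k n (dbar i P) * UniversalEnvelopingAlgebra.ι k (adBar i a) = 0 := by
  refine finsum_mem_of_eqOn_zero fun i hi => ?_
  obtain ⟨p, hp⟩ := exists_inr_ne_zero (hs i hi).1 (hs i hi).2
  simp only [adBar_eq_zero i p hp, _root_.map_zero, mul_zero, Pi.zero_apply]

/-- An index of `x`-degree one is either a single `x_b` or involves some `y`, and in the second case
its term vanishes. This turns the infinite index set into the finite set `t`. -/
theorem finsum_mem_xDegree_one (s : Set (ZIdx n →₀ ℕ)) (hs : ∀ i ∈ s, xDegree i = 1)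
    (t : Finset (Fin (n + 1))) (ht : ∀ a, Finsupp.single (Sum.inl a) 1 ∈ s ↔ a ∈ t)
    (a : g2 k n) (P : Kz k n) :
    ∑ᶠ i ∈ s, ord k n (dbar i P) * UniversalEnvelopingAlgebra.ι k (adBar i a) =
      -∑ b ∈ t, ord k n (pderiv (Sum.inl b) P) *
        UniversalEnvelopingAlgebra.ι k ⁅xLie k n b, a⁆ := by
  classical
  have hinj : Function.Injective fun b : Fin (n + 1) => Finsupp.single (Sum.inl b : ZIdx n) 1 :=
    (Finsupp.single_left_injective one_ne_zero).comp Sum.inl_injective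
  rw [finsum_mem_eq_sum_of_inter_support_eq
    (t := t.map ⟨fun b => Finsupp.single (Sum.inl b) 1, hinj⟩), Finset.sum_map,
    ← Finset.sum_neg_distrib]
  · refine Finset.sum_congr rfl fun b _ => ?_
    simp only [Function.Embedding.coeFn_mk, dbar_single, adBar_single, map_neg, neg_mul]
    rfl
  · ext i
    simp only [Set.mem_inter_iff, Finset.coe_map, Function.Embedding.coeFn_mk, Set.mem_image,
      Finset.mem_coe, Function.mem_support]
    refine ⟨fun ⟨hi, h0⟩ => ⟨?_, h0⟩, ?_⟩
    · obtain ⟨b, rfl⟩ := eq_single_of_xDegree_eq_one (hs i hi) fun p => by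
        by_contra hp
        exact h0 (by rw [adBar_eq_zero i p hp, _root_.map_zero, mul_zero])
      exact ⟨b, (ht b).1 hi, rfl⟩
    · rintro ⟨⟨b, hb, rfl⟩, h0⟩
      exact ⟨(ht b).2 hb, h0⟩

theorem Delta_zero (j : ZIdx n) (P : Kz k n) : Delta j 0 P = 0 :=
  -- The condition `|i|_j > 0` rules out `i = 0`, the one index whose term could survive.
  finsum_mem_xDegree_zero _ (fun i hi => ⟨hi.1, fun h => by
    have := hi.2
    simp [h, partialDegree] at this⟩) _ P

theorem Nabla_zero (j : ZIdx n) (P : Kz k n) : Nabla j 0 P = 0 := by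
  rw [Nabla, finsum_mem_xDegree_zero _ (fun i hi => ⟨hi.1, hi.2.2⟩) _ P, neg_zero]

theorem ord_mul_ι_lie (a j : Fin (n + 1)) (Q : Kz k n) :
    ord k n Q * UniversalEnvelopingAlgebra.ι k ⁅xLie k n a, zLie k n (Sum.inl j)⁆ =
      ord k n ((yVar k a j - yVar k j a) * Q) := by
  rcases lt_trichotomy a j with h | h | h
  · rw [yVar, yVar, dif_pos h, dif_neg h.not_gt, sub_zero, ← ord_mul_ι_y]
    rfl
  · subst h
    rw [sub_self, zero_mul, map_zero]
    rw [show zLie k n (Sum.inl a) = xLie k n a from rfl, lie_self, _root_.map_zero, mul_zero]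
  · rw [yVar, yVar, dif_pos h, dif_neg h.not_gt, zero_sub, neg_mul, map_neg, ← ord_mul_ι_y,
      ← lie_skew, _root_.map_neg, mul_neg]
    rfl

/-- The condition `|i|_j > 0` selects `a ≤ j`. The sum may run over all `a`, since `yVar k a j`
vanishes unless `a < j`. -/
theorem Delta_one (j : Fin (n + 1)) (P : Kz k n) :
    Delta (Sum.inl j) 1 P =
      ord k n (-∑ a, yVar k a j * pderiv (Sum.inl a) P) := by
  rw [Delta, finsum_mem_xDegree_one _ (fun i hi => hi.1) (Finset.univ.filter (· ≤ j)), map_neg,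
    map_sum, Finset.sum_filter]
  · congr 1
    refine Finset.sum_congr rfl fun a _ => ?_
    split_ifs with h
    · rw [ord_mul_ι_lie, show yVar k j a = 0 from dif_neg (not_lt.2 h), sub_zero]
    · rw [show yVar k a j = 0 from dif_neg fun h' => h h'.le, zero_mul, map_zero]
  · intro a
    simp only [Set.mem_ofPred_eq, xDegree_single, partialDegree_single, Finset.mem_filter,
      Finset.mem_univ, true_and]
    split_ifs with h <;> simp [h]

/-- The sign in front of `∇` cancels that of `∂̄`; the remaining minus comes from `[x_a, x_j] =
-y_{ja}` for `a > j`. -/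
theorem Nabla_one (j : Fin (n + 1)) (P : Kz k n) :
    Nabla (Sum.inl j) 1 P =
      ord k n (-∑ a, yVar k j a * pderiv (Sum.inl a) P) := by
  rw [Nabla, finsum_mem_xDegree_one _ (fun i hi => hi.1) (Finset.univ.filter (¬ · ≤ j)), map_neg,
    map_sum, neg_neg, Finset.sum_filter, ← Finset.sum_neg_distrib]
  · refine Finset.sum_congr rfl fun a _ => ?_
    by_cases h : a ≤ j
    · rw [if_neg (not_not.2 h), show yVar k j a = 0 from dif_neg (not_lt.2 h), zero_mul, map_zero,
        neg_zero]
    · rw [if_pos h, ord_mul_ι_lie, show yVar k a j = 0 from dif_neg fun h' => h h'.le, zero_sub,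
        neg_mul, map_neg]
  · intro a
    simp only [Set.mem_ofPred_eq, xDegree_single, partialDegree_single, Finset.mem_filter,
      Finset.mem_univ, true_and]
    split_ifs with h <;> simp [h]

/-! ## The components `S ⊗ R₂ᵐ⟨y⟩` in `k[z]` -/

theorem toKz_add {m : ℕ} (f g : SR k n m) : toKz (f + g) = toKz f + toKz g := by
  simp [toKz, add_mul, Finset.sum_add_distrib]

/-- `toKz` as an additive map. -/
def toKzHom (k : Type u) [Field k] (n m : ℕ) : SR k n m →+ Kz k n :=
  AddMonoidHom.mk' toKz toKz_add

theorem toKz_zero (m : ℕ) : toKz (0 : SR k n m) = 0 := map_zero (toKzHom k n m)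

theorem toKz_neg {m : ℕ} (f : SR k n m) : toKz (-f) = -toKz f := map_neg (toKzHom k n m) f

theorem toKz_sum {m : ℕ} {ι : Type*} (s : Finset ι) (f : ι → SR k n m) :
    toKz (∑ i ∈ s, f i) = ∑ i ∈ s, toKz (f i) := map_sum (toKzHom k n m) f s

theorem toKz_single {m : ℕ} (α : YMon n m) (a : S k n) :
    toKz (Pi.single α a) = rename Sum.inl a * ∏ p : YIdx n, X (Sum.inr p) ^ α.1 p := by
  rw [toKz, Finset.sum_eq_single α]
  · rw [Pi.single_eq_same]
  · intro β _ hβ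
    rw [Pi.single_eq_of_ne hβ, map_zero, zero_mul]
  · simp

/-- `k[z]` viewed as `k[x][y]`. -/
def yPoly (k : Type u) [Field k] (n : ℕ) : Kz k n →ₐ[k] MvPolynomial (YIdx n) (S k n) :=
  aeval (Sum.elim (fun a => C (X a)) X)

theorem yPoly_rename (f : S k n) : yPoly k n (rename Sum.inl f) = C f := by
  have h : (yPoly k n).comp (rename Sum.inl) =
      IsScalarTower.toAlgHom k (S k n) (MvPolynomial (YIdx n) (S k n)) := by
    refine algHom_ext fun a => ?_
    simp [yPoly, algebraMap_eq]
  exact congrArg (fun φ => φ f) h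

/-- Viewing `k[z]` as `k[x][y]` recovers the components of `f` as coefficients, whence `toKz` is
injective. -/
theorem coeff_yPoly_toKz {m : ℕ} (f : SR k n m) (β : YMon n m) :
    coeff (Finsupp.equivFunOnFinite.symm β.1) (yPoly k n (toKz f)) = f β := by
  have h (α : YMon n m) : yPoly k n (rename Sum.inl (f α) * ∏ p : YIdx n, X (Sum.inr p) ^ α.1 p) =
      monomial (Finsupp.equivFunOnFinite.symm α.1) (f α) := by
    rw [map_mul, yPoly_rename, map_prod, monomial_eq, Finsupp.prod_fintype _ _ fun _ => pow_zero _]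
    congr 1
    refine Finset.prod_congr rfl fun p _ => ?_
    simp [yPoly]
  rw [toKz, map_sum, coeff_sum, Finset.sum_eq_single β]
  · rw [h, coeff_monomial, if_pos rfl]
  · intro α _ hα
    rw [h, coeff_monomial, if_neg]
    exact fun e => hα (Subtype.ext (Finsupp.equivFunOnFinite.symm.injective e))
  · simp

theorem toKz_injective (m : ℕ) : Function.Injective (toKz : SR k n m → Kz k n) := by
  intro f g h
  funext β
  rw [← coeff_yPoly_toKz f, h, coeff_yPoly_toKz]

theorem pderiv_toKz {m : ℕ} (a : Fin (n + 1)) (f : SR k n m) :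
    pderiv (Sum.inl a) (toKz f) = toKz fun α => pderiv a (f α) := by
  rw [toKz, toKz, map_sum]
  refine Finset.sum_congr rfl fun α _ => ?_
  have h : pderiv (Sum.inl a) (∏ p : YIdx n, (X (Sum.inr p) : Kz k n) ^ α.1 p) = 0 := by
    refine Finset.prod_induction _ (fun P : Kz k n => pderiv (Sum.inl a) P = 0) ?_
      (Derivation.map_one_eq_zero _) fun p _ => ?_
    · intro P Q hP hQ
      rw [Derivation.leibniz, hP, hQ, smul_zero, smul_zero, add_zero]
    · rw [Derivation.leibniz_pow, pderiv_X_of_ne (by simp), smul_zero, smul_zero]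
  rw [Derivation.leibniz, h, smul_zero, zero_add, smul_eq_mul, mul_comm,
    pderiv_rename Sum.inl_injective]

/-- The exponent of `y_p · y^α`. -/
def YMon.succ {m : ℕ} (p : YIdx n) (α : YMon n m) : YMon n (m + 2) :=
  ⟨α.1 + Pi.single p 1, by
    have := α.2
    simp only [Pi.add_apply, Finset.sum_add_distrib, Finset.sum_pi_single', Finset.mem_univ,
      if_true]
    omega⟩

theorem YMon.succ_inj {m : ℕ} {p q : YIdx n} {α : YMon n m} (h : α.succ p = α.succ q) : p = q := by
  have h1 : (Pi.single p 1 : YIdx n → ℕ) = Pi.single q 1 :=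
    add_left_cancel (congrArg Subtype.val h)
  by_contra hc
  have := congrFun h1 p
  simp [hc] at this

/-- Multiplication by `y_p` on `S ⊗ R₂ᵐ⟨y⟩`. -/
def shift {m : ℕ} (p : YIdx n) (f : SR k n m) : SR k n (m + 2) :=
  ∑ α, Pi.single (α.succ p) (f α)

theorem toKz_shift {m : ℕ} (p : YIdx n) (f : SR k n m) :
    toKz (shift p f) = X (Sum.inr p) * toKz f := by
  rw [shift, toKz_sum, toKz, Finset.mul_sum]
  refine Finset.sum_congr rfl fun α _ => ?_
  rw [toKz_single]
  have : ∏ q : YIdx n, (X (Sum.inr q) : Kz k n) ^ (α.succ p).1 q =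
      X (Sum.inr p) * ∏ q : YIdx n, X (Sum.inr q) ^ α.1 q := by
    have h (q : YIdx n) : (X (Sum.inr q) : Kz k n) ^ (α.succ p).1 q =
        X (Sum.inr q) ^ α.1 q * if q = p then X (Sum.inr q) else 1 := by
      rw [show (α.succ p).1 q = α.1 q + Pi.single (M := fun _ => ℕ) p 1 q from rfl, pow_add, Pi.single_apply]
      split_ifs <;> simp
    rw [Finset.prod_congr rfl fun q _ => h q, Finset.prod_mul_distrib, mul_comm]
    simp
  rw [this]
  ring

theorem shift_single {m : ℕ} (p : YIdx n) (α : YMon n m) (a : S k n) :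
    shift p (Pi.single α a) = Pi.single (α.succ p) a := by
  rw [shift, Finset.sum_eq_single α]
  · rw [Pi.single_eq_same]
  · intro β _ hβ
    rw [Pi.single_eq_of_ne hβ, Pi.single_zero]
  · simp

theorem shift_apply_mem {m : ℕ} (p : YIdx n) (f : SR k n m) (J : YMon n (m + 2) → Ideal (S k n))
    (h : ∀ α, f α ∈ J (α.succ p)) (β : YMon n (m + 2)) : shift p f β ∈ J β := by
  rw [shift, Finset.sum_apply]
  refine Ideal.sum_mem _ fun α _ => ?_
  by_cases e : β = α.succ p
  · subst e
    rw [Pi.single_eq_same]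
    exact h α
  · rw [Pi.single_eq_of_ne e]
    exact Ideal.zero_mem _

/-- Multiplication by `y_{ab}`, understood as `0` unless `a < b`. -/
def yShift {m : ℕ} (a b : Fin (n + 1)) (f : SR k n m) : SR k n (m + 2) :=
  if h : a < b then shift ⟨(a, b), h⟩ f else 0

theorem toKz_yShift {m : ℕ} (a b : Fin (n + 1)) (f : SR k n m) :
    toKz (yShift a b f) = yVar k a b * toKz f := by
  unfold yShift yVar
  split_ifs
  · exact toKz_shift _ _
  · rw [toKz_zero, zero_mul]

theorem yShift_single_apply {m : ℕ} (p : YIdx n) (a b : Fin (n + 1)) (α : YMon n m) (f : S k n) :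
    yShift a b (Pi.single α f) (α.succ p) = if p.1 = (a, b) then f else 0 := by
  unfold yShift
  split_ifs with h h' h'
  · obtain rfl : p = ⟨(a, b), h⟩ := Subtype.ext h'
    rw [shift_single, Pi.single_eq_same]
  · rw [shift_single, Pi.single_eq_of_ne]
    exact fun e => h' (congrArg Subtype.val (YMon.succ_inj e))
  · exact absurd (by simpa [h'] using p.2) h
  · rfl

/-- The operator `Δ_{x_j,1}` on `S ⊗ R₂ᵐ⟨y⟩`. -/
def deltaSR {m : ℕ} (j : Fin (n + 1)) (f : SR k n m) : SR k n (m + 2) :=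
  -∑ a, yShift a j fun α => pderiv a (f α)

/-- The operator `∇_{x_j,1}` on `S ⊗ R₂ᵐ⟨y⟩`. -/
def nablaSR {m : ℕ} (j : Fin (n + 1)) (f : SR k n m) : SR k n (m + 2) :=
  -∑ a, yShift j a fun α => pderiv a (f α)

theorem Delta_one_toKz {m : ℕ} (j : Fin (n + 1)) (f : SR k n m) :
    Delta (Sum.inl j) 1 (toKz f) = ord k n (toKz (deltaSR j f)) := by
  rw [Delta_one, deltaSR, toKz_neg, toKz_sum]
  simp only [toKz_yShift, pderiv_toKz]

theorem Nabla_one_toKz {m : ℕ} (j : Fin (n + 1)) (f : SR k n m) :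
    Nabla (Sum.inl j) 1 (toKz f) = ord k n (toKz (nablaSR j f)) := by
  rw [Nabla_one, nablaSR, toKz_neg, toKz_sum]
  simp only [toKz_yShift, pderiv_toKz]

theorem pderiv_single {m : ℕ} (a : Fin (n + 1)) (α : YMon n m) (f : S k n) :
    (fun β => pderiv a ((Pi.single α f : SR k n m) β)) = Pi.single α (pderiv a f) := by
  funext β
  exact Pi.apply_single (fun _ => ⇑(pderiv (R := k) a)) (fun _ => map_zero _) α f β

/-- The monomials `y_{aj} y^α` are distinct for distinct `a` (`YMon.succ_inj`), so one coordinate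
isolates one partial derivative. -/
theorem deltaSR_single_apply {m : ℕ} (p : YIdx n) (α : YMon n m) (f : S k n) :
    deltaSR p.1.2 (Pi.single α f) (α.succ p) = -pderiv p.1.1 f := by
  rw [deltaSR, Pi.neg_apply, Finset.sum_apply, Finset.sum_eq_single p.1.1]
  · rw [pderiv_single, yShift_single_apply, if_pos rfl]
  · intro a _ ha
    rw [pderiv_single, yShift_single_apply, if_neg]
    exact fun e => ha (congrArg Prod.fst e).symm
  · simp

theorem nablaSR_single_apply {m : ℕ} (p : YIdx n) (α : YMon n m) (f : S k n) :
    nablaSR p.1.1 (Pi.single α f) (α.succ p) = -pderiv p.1.2 f := by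
  rw [nablaSR, Pi.neg_apply, Finset.sum_apply, Finset.sum_eq_single p.1.2]
  · rw [pderiv_single, yShift_single_apply, if_pos rfl]
  · intro a _ ha
    rw [pderiv_single, yShift_single_apply, if_neg]
    exact fun e => ha (congrArg Prod.snd e).symm
  · simp

/-! ## Families of ideals indexed by the exponents of the `y`-monomials -/

theorem isHomogeneous_iff_homogeneousComponent_mem (J : Ideal (S k n)) :
    J.IsHomogeneous (grading k n) ↔ ∀ f ∈ J, ∀ d, homogeneousComponent d f ∈ J := by
  have h (f : S k n) (d : ℕ) :
      (DirectSum.decompose (grading k n) f d : S k n) = homogeneousComponent d f :=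
    decomposition.decompose'_apply f d
  refine ⟨fun hJ f hf d => ?_, fun hJ d f hf => ?_⟩
  · rw [← h]
    exact hJ d hf
  · rw [h]
    exact hJ f hf d

/-- The inclusions required of the ideals of two exponents which differ by `y_p`. -/
def DerivLE (p : YIdx n) (I J : Ideal (S k n)) : Prop :=
  ∀ f ∈ I, f ∈ J ∧ pderiv p.1.1 f ∈ J ∧ pderiv p.1.2 f ∈ J

theorem deltaSR_apply_mem {J : (YIdx n → ℕ) → Ideal (S k n)}
    (h : ∀ α p, DerivLE p (J α) (J (α + Pi.single p 1))) {m : ℕ} (j : Fin (n + 1))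
    (f : SR k n m) (hf : ∀ α, f α ∈ J α.1) (β : YMon n (m + 2)) : deltaSR j f β ∈ J β.1 := by
  rw [deltaSR, Pi.neg_apply, Finset.sum_apply]
  refine neg_mem (Ideal.sum_mem _ fun a _ => ?_)
  unfold yShift
  split_ifs with ha
  · exact shift_apply_mem _ _ (fun β => J β.1)
      (fun α => (h α.1 ⟨(a, j), ha⟩ _ (hf α)).2.1) β
  · exact Ideal.zero_mem _

theorem nablaSR_apply_mem {J : (YIdx n → ℕ) → Ideal (S k n)}
    (h : ∀ α p, DerivLE p (J α) (J (α + Pi.single p 1))) {m : ℕ} (j : Fin (n + 1))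
    (f : SR k n m) (hf : ∀ α, f α ∈ J α.1) (β : YMon n (m + 2)) : nablaSR j f β ∈ J β.1 := by
  rw [nablaSR, Pi.neg_apply, Finset.sum_apply]
  refine neg_mem (Ideal.sum_mem _ fun a _ => ?_)
  unfold yShift
  split_ifs with ha
  · exact shift_apply_mem _ _ (fun β => J β.1)
      (fun α => (h α.1 ⟨(j, a), ha⟩ _ (hf α)).2.2) β
  · exact Ideal.zero_mem _

/-- The differential chain `I_m = ⨁ J_α y^α` of a family of graded ideals. -/
def chainOfIdeals (J : (YIdx n → ℕ) → Ideal (S k n))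
    (hJ : ∀ α, (J α).IsHomogeneous (grading k n))
    (h : ∀ α p, DerivLE p (J α) (J (α + Pi.single p 1))) : DifferentialChain k n where
  I m := Submodule.pi Set.univ fun α : YMon n m => J α.1
  graded m f hf d := fun α _ =>
    (isHomogeneous_iff_homogeneousComponent_mem _).1 (hJ α.1) _ (hf α trivial) d
  chain m p f hf := by
    refine ⟨shift p f, fun β _ => ?_, (toKz_shift p f).symm⟩
    exact shift_apply_mem p f (fun β => J β.1) (fun α => (h α.1 p _ (hf α trivial)).1) β
  delta m j l hl f hf := by
    rcases l with _ | l
    · exact ⟨0, Submodule.zero_mem _, by rw [Delta_zero, toKz_zero, map_zero]⟩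
    · rcases j with j | p
      · obtain rfl : l = 0 := by simp only [zDeg] at hl; omega
        refine ⟨deltaSR j f, fun β _ => ?_, Delta_one_toKz j f⟩
        exact deltaSR_apply_mem h j f (fun α => hf α trivial) β
      · simp only [zDeg] at hl
        omega
  nabla m j l hl f hf := by
    rcases l with _ | l
    · exact ⟨0, Submodule.zero_mem _, by rw [Nabla_zero, toKz_zero, map_zero]⟩
    · rcases j with j | p
      · obtain rfl : l = 0 := by simp only [zDeg] at hl; omega
        refine ⟨nablaSR j f, fun β _ => ?_, Nabla_one_toKz j f⟩
        exact nablaSR_apply_mem h j f (fun α => hf α trivial) β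
      · simp only [zDeg] at hl
        omega

theorem apply_mem_of_mem_chainOfIdeals (J : (YIdx n → ℕ) → Ideal (S k n)) (hJ h) {m : ℕ}
    {f : SR k n m} (hf : f ∈ (chainOfIdeals J hJ h).I m) (α : YMon n m) : f α ∈ J α.1 :=
  hf α trivial

theorem isIdealChain_chainOfIdeals (J : (YIdx n → ℕ) → Ideal (S k n)) (hJ h) :
    (chainOfIdeals J hJ h).IsIdealChain :=
  fun _ a _ hf α _ => Ideal.mul_mem_left _ (a α) (hf α trivial)

theorem baseIdeal_chainOfIdeals (J : (YIdx n → ℕ) → Ideal (S k n)) (hJ h) :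
    (chainOfIdeals J hJ h).baseIdeal = J 0 := by
  ext f
  refine ⟨fun hf => hf ⟨0, by simp⟩ trivial, fun hf α _ => ?_⟩
  have : α.1 = 0 := by
    funext p
    have h2 := α.2
    simp only [mul_eq_zero, OfNat.ofNat_ne_zero, false_or] at h2
    exact Finset.sum_eq_zero_iff.1 h2 p (Finset.mem_univ p)
  simpa [this] using hf

/-! ## Nonvanishing of the sheaves -/

/-- From `∂_i x_i^{d+1} = (d+1) x_i^d` and the invertibility of `d+1`, a power of `x_i` in `J` would
descend to `1 ∈ J`. -/
theorem X_pow_notMem [CharZero k] (J : Ideal (S k n)) (hJ : J ≠ ⊤) (i : Fin (n + 1))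
    (h : ∀ f ∈ J, pderiv i f ∈ J) (d : ℕ) : (X i : S k n) ^ d ∉ J := by
  induction d with
  | zero =>
    rw [pow_zero]
    exact (Ideal.ne_top_iff_one J).1 hJ
  | succ d ih =>
    intro hd
    have h1 := h _ hd
    rw [Derivation.leibniz_pow, pderiv_X_self, Nat.add_sub_cancel, smul_eq_mul, mul_one,
      nsmul_eq_mul] at h1
    have h2 := J.mul_mem_left (C ((d + 1 : ℕ) : k)⁻¹) h1
    rw [← mul_assoc, ← map_natCast (C : k →+* S k n), ← map_mul,
      inv_mul_cancel₀ (Nat.cast_ne_zero.2 d.succ_ne_zero), map_one, one_mul] at h2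
    exact ih h2

/-- A prime over `J` disjoint from the powers of `x_i` exists; its homogeneous core is still prime,
still contains the homogeneous `J`, and omits `x_i`, hence is relevant. -/
theorem exists_projectiveSpectrum_le (J : Ideal (S k n)) (hJ : J.IsHomogeneous (grading k n))
    (i : Fin (n + 1)) (h : ∀ d : ℕ, (X i : S k n) ^ d ∉ J) :
    ∃ x : ProjectiveSpectrum (grading k n), J ≤ x.asHomogeneousIdeal.toIdeal ∧
      (X i : S k n) ∉ x.asHomogeneousIdeal.toIdeal := by
  obtain ⟨q, hq, hJq, hdis⟩ := Ideal.exists_le_prime_disjoint J (Submonoid.powers (X i : S k n))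
    (Set.disjoint_left.2 (by rintro _ hf ⟨d, rfl⟩; exact h d hf))
  have hX : (X i : S k n) ∉ q :=
    fun hi => Set.disjoint_left.1 hdis hi (Submonoid.mem_powers _)
  have hle : (q.homogeneousCore (grading k n)).toIdeal ≤ q :=
    Ideal.toIdeal_homogeneousCore_le _ _
  refine ⟨⟨q.homogeneousCore (grading k n), hq.homogeneousCore, fun hirr => hX (hle (hirr ?_))⟩,
    ?_, fun hi => hX (hle hi)⟩
  · rw [HomogeneousIdeal.mem_irrelevant_iff, GradedRing.proj_apply]
    exact DirectSum.decompose_of_mem_ne _ (isHomogeneous_X k i) one_ne_zero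
  · exact (Ideal.homogeneousCore.gc (grading k n) ⟨J, hJ⟩ q).1 hJq

/-- The section is `1 / x_i^m` on `D(x_i)`. If it vanished at a point over `J`, some `u x_i^m` with
`u` outside the prime would lie in `J` at the coordinate `α`. -/
theorem exists_section_ne_zero (C : DifferentialChain k n) (m : ℕ) (α : YMon n m)
    (J : Ideal (S k n)) (hJ : J.IsHomogeneous (grading k n)) (hC : ∀ f ∈ C.I m, f α ∈ J)
    (i : Fin (n + 1)) (h : ∀ d : ℕ, (X i : S k n) ^ d ∉ J) :
    ∃ U, ∃ s ∈ C.structureSections U, s m ≠ 0 := by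
  obtain ⟨x, hJx, hix⟩ := exists_projectiveSpectrum_le J hJ i h
  let U := ProjectiveSpectrum.basicOpen (grading k n) (X i : S k n)
  have hU (y : U) (m' : ℕ) : (X i : S k n) ^ m' ∈ y.1.asHomogeneousIdeal.toIdeal.primeCompl :=
    Submonoid.pow_mem _ (show X i ∈ y.1.asHomogeneousIdeal.toIdeal.primeCompl from y.2) m'
  refine ⟨U, fun m' y => LocalizedModule.mk (Submodule.Quotient.mk 1) ⟨X i ^ m', hU y m'⟩, ?_, ?_⟩
  · intro m' _ y
    refine ⟨U, y.2, 0, Submodule.Quotient.mk 1, ⟨1, fun _ => SetLike.GradedOne.one_mem, rfl⟩,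
      X i ^ m', ?_, fun z _ => ⟨hU z m', rfl⟩⟩
    rw [zero_add]
    exact isHomogeneous_X_pow i m'
  · intro h0
    have h1 := congrFun h0 ⟨x, hix⟩
    rw [Pi.zero_apply, ← LocalizedModule.zero_mk ⟨X i ^ m, hU ⟨x, hix⟩ m⟩] at h1
    obtain ⟨u, hu⟩ := LocalizedModule.mk_eq.1 h1
    rw [smul_zero, smul_zero] at hu
    have h2 : (u : S k n) • (X i ^ m : S k n) • (1 : SR k n m) ∈ C.I m :=
      (Submodule.Quotient.mk_eq_zero _).1 hu
    have h3 := hC _ h2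
    rw [Pi.smul_apply, Pi.smul_apply, Pi.one_apply, smul_eq_mul, smul_eq_mul, mul_one] at h3
    exact Submonoid.mul_mem _ u.2 (hU ⟨x, hix⟩ m) (hJx h3)

/-! ### Construction of an infinite quantization from `J`. -/

theorem admits_of_ideal [CharZero k] (I₀ : Ideal (S k n)) (hI₀ : I₀.IsHomogeneous (grading k n))
    (p : YIdx n) (J : Ideal (S k n)) (hJ : J.IsHomogeneous (grading k n)) (hJt : J ≠ ⊤)
    (hJJ : DerivLE p J J) (hIJ : DerivLE p I₀ J) : AdmitsInfiniteGeometricQuantization I₀ := by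
  classical
  let F : (YIdx n → ℕ) → Ideal (S k n) := fun α =>
    if α = 0 then I₀ else if ∃ t, α = Pi.single p t then J else ⊤
  have hF : ∀ α, (F α).IsHomogeneous (grading k n) := by
    intro α
    simp only [F]
    split_ifs
    · exact hI₀
    · exact hJ
    · exact Ideal.IsHomogeneous.top _
  have hne (α : YIdx n → ℕ) (q : YIdx n) : α + Pi.single q 1 ≠ 0 := by
    intro e
    have := congrFun e q
    simp at this
  -- A step ending on the ray of `p` must have direction `p` and start on that ray; any other step
  -- ends in `⊤`.
  have hstep : ∀ α q, DerivLE q (F α) (F (α + Pi.single q 1)) := by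
    intro α q
    by_cases ht : ∃ t, α + Pi.single q 1 = Pi.single p t
    · have hT : F (α + Pi.single q 1) = J := by simp only [F, if_neg (hne α q), if_pos ht]
      rw [hT]
      obtain ⟨t, ht⟩ := ht
      obtain rfl : q = p := by
        by_contra hqp
        have := congrFun ht q
        simp [hqp] at this
      -- Evaluation of `ht` at `q` shows `t ≥ 1`, so the subtraction is not truncated.
      have hα : α = Pi.single q (t - 1) := by
        funext r
        have := congrFun ht r
        by_cases hr : r = q
        · subst hr
          simp only [Pi.add_apply, Pi.single_eq_same] at this ⊢
          omega
        · simpa [Pi.single_eq_of_ne hr] using this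
      by_cases h0 : α = 0
      · simpa only [F, if_pos h0] using hIJ
      · simpa only [F, if_neg h0, if_pos (⟨_, hα⟩ : ∃ t, α = Pi.single q t)] using hJJ
    · have hT : F (α + Pi.single q 1) = ⊤ := by simp only [F, if_neg (hne α q), if_neg ht]
      rw [hT]
      exact fun f _ => ⟨trivial, trivial, trivial⟩
  refine ⟨chainOfIdeals F hF hstep, ?_, isIdealChain_chainOfIdeals _ _ _, ?_⟩
  · rw [baseIdeal_chainOfIdeals]
    exact if_pos rfl
  -- The shift to `t + 1` avoids the origin, where `F` is `I₀` instead of `J`.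
  · refine Set.infinite_of_injective_forall_mem (f := fun t : ℕ => 2 * (t + 1))
      (fun a b hab => by simpa using hab) fun t => ?_
    refine exists_section_ne_zero _ (2 * (t + 1)) ⟨Pi.single p (t + 1), by simp⟩ J hJ ?_ p.1.1
      (X_pow_notMem J hJt p.1.1 fun f hf => (hJJ f hf).2.1)
    intro f hf
    have h1 : F (Pi.single p (t + 1)) = J := by
      have h0 : (Pi.single p (t + 1) : YIdx n → ℕ) ≠ 0 := by simp
      simp only [F, if_neg h0]
      exact if_pos ⟨_, rfl⟩
    have h2 := apply_mem_of_mem_chainOfIdeals F hF hstep hf ⟨Pi.single p (t + 1), by simp⟩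
    rwa [h1] at h2

/-! ## The ideals of a differential chain -/

namespace DifferentialChain

/-- The ideal of all `f` with `f y^α ∈ I_m`. -/
def coeffIdeal (C : DifferentialChain k n) (α : YIdx n → ℕ) : Ideal (S k n) :=
  (C.I (2 * ∑ p, α p)).comap
    (LinearMap.single (S k n) (fun _ : YMon n (2 * ∑ p, α p) => S k n) ⟨α, rfl⟩)

theorem single_mem_iff (C : DifferentialChain k n) {m : ℕ} (α : YMon n m) (f : S k n) :
    (Pi.single α f : SR k n m) ∈ C.I m ↔ f ∈ C.coeffIdeal α.1 := by
  obtain ⟨α, rfl⟩ := α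
  rfl

theorem isHomogeneous_coeffIdeal (C : DifferentialChain k n) (α : YIdx n → ℕ) :
    (C.coeffIdeal α).IsHomogeneous (grading k n) := by
  rw [isHomogeneous_iff_homogeneousComponent_mem]
  intro f hf d
  have h := C.graded _ _ hf d
  simp only [LinearMap.coe_single] at h
  have e : (fun β => homogeneousComponent d
      ((Pi.single ⟨α, rfl⟩ f : SR k n (2 * ∑ p, α p)) β)) =
      (Pi.single ⟨α, rfl⟩ (homogeneousComponent d f) : SR k n (2 * ∑ p, α p)) := by
    funext β
    exact Pi.apply_single (fun _ => ⇑(homogeneousComponent (σ := Fin (n + 1)) (R := k) d))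
      (fun _ => map_zero _) (⟨α, rfl⟩ : YMon n (2 * ∑ p, α p)) f β
  rw [e] at h
  exact h

theorem coeffIdeal_zero (C : DifferentialChain k n) : C.coeffIdeal 0 = C.baseIdeal := by
  have hsub : ∀ α : YMon n 0, α = ⟨0, by simp⟩ := fun α => Subtype.ext <| funext fun p => by
    have h2 := α.2
    simp only [mul_eq_zero, OfNat.ofNat_ne_zero, false_or] at h2
    exact Finset.sum_eq_zero_iff.1 h2 p (Finset.mem_univ p)
  ext f
  rw [← C.single_mem_iff (⟨0, by simp⟩ : YMon n 0) f]
  have : (Pi.single ⟨0, by simp⟩ f : SR k n 0) = Algebra.linearMap (S k n) (SR k n 0) f := by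
    funext α
    rw [hsub α, Pi.single_eq_same]
    rfl
  rw [this]
  rfl

/-- Multiplication by the idempotent `Pi.single α 1` cuts out the component at `α`. This is where
the ideal property of the chain enters. -/
theorem apply_mem_coeffIdeal {C : DifferentialChain k n} (hC : C.IsIdealChain) {m : ℕ}
    {g : SR k n m} (hg : g ∈ C.I m) (α : YMon n m) : g α ∈ C.coeffIdeal α.1 := by
  rw [← C.single_mem_iff α]
  have h := hC m (Pi.single α 1) g hg
  rwa [← Pi.single_mul_left, one_mul] at h

theorem derivLE_coeffIdeal {C : DifferentialChain k n} (hC : C.IsIdealChain) (α : YIdx n → ℕ)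
    (p : YIdx n) : DerivLE p (C.coeffIdeal α) (C.coeffIdeal (α + Pi.single p 1)) := by
  intro f hf
  let α' : YMon n (2 * ∑ p, α p) := ⟨α, rfl⟩
  refine ⟨?_, ?_, ?_⟩
  · obtain ⟨g, hg, e⟩ := C.chain _ p _ hf
    -- The chain only asserts that some `g` exists; injectivity of `toKz`, and below of `ord` as
    -- well, identifies it.
    have hg' : g = shift p (Pi.single α' f) := toKz_injective _ (e.symm.trans (toKz_shift p _).symm)
    have h := apply_mem_coeffIdeal hC hg (α'.succ p)
    rw [hg', shift_single] at h
    exact (Pi.single_eq_same (M := fun _ => S k n) (α'.succ p) f) ▸ h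
  · obtain ⟨g, hg, e⟩ := C.delta _ (Sum.inl p.1.2) 1 le_rfl _ hf
    have hg' : g = deltaSR p.1.2 (Pi.single α' f) :=
      toKz_injective _ (ord_injective k n (e.symm.trans (Delta_one_toKz _ _)))
    have h := apply_mem_coeffIdeal hC hg (α'.succ p)
    rw [hg', deltaSR_single_apply] at h
    exact neg_mem_iff.1 h
  · obtain ⟨g, hg, e⟩ := C.nabla _ (Sum.inl p.1.1) 1 le_rfl _ hf
    have hg' : g = nablaSR p.1.1 (Pi.single α' f) :=
      toKz_injective _ (ord_injective k n (e.symm.trans (Nabla_one_toKz _ _)))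
    have h := apply_mem_coeffIdeal hC hg (α'.succ p)
    rw [hg', nablaSR_single_apply] at h
    exact neg_mem_iff.1 h

/-- Multiplication by one `y_p` at a time, by induction on the total degree of the difference. -/
theorem coeffIdeal_mono {C : DifferentialChain k n} (hC : C.IsIdealChain) :
    Monotone C.coeffIdeal := by
  have key : ∀ d : ℕ, ∀ α δ : YIdx n → ℕ, ∑ p, δ p = d →
      C.coeffIdeal α ≤ C.coeffIdeal (α + δ) := by
    intro d
    induction d with
    | zero =>
      intro α δ h
      have : δ = 0 := funext fun p => Finset.sum_eq_zero_iff.1 h p (Finset.mem_univ p)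
      rw [this, add_zero]
    | succ d ih =>
      intro α δ h
      obtain ⟨p, _, hp⟩ : ∃ p ∈ Finset.univ, δ p ≠ 0 := by
        refine Finset.exists_ne_zero_of_sum_ne_zero ?_
        omega
      have hle : Pi.single p 1 ≤ δ := by
        intro q
        by_cases hq : q = p
        · subst hq
          rw [Pi.single_eq_same]
          exact Nat.one_le_iff_ne_zero.2 hp
        · rw [Pi.single_eq_of_ne hq]
          exact Nat.zero_le _
      have e : δ = δ - Pi.single p 1 + Pi.single p 1 := (tsub_add_cancel_of_le hle).symm
      have hs : ∑ q, (δ - Pi.single p 1 : YIdx n → ℕ) q = d := by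
        rw [e] at h
        simp only [Pi.add_apply, Finset.sum_add_distrib, Finset.sum_pi_single', Finset.mem_univ,
          if_true] at h
        omega
      rw [e, ← add_assoc]
      exact (ih α _ hs).trans fun f hf => (derivLE_coeffIdeal hC _ p f hf).1
  intro α β hαβ
  rw [← add_tsub_cancel_of_le hαβ]
  exact key _ α _ rfl

theorem exists_coeffIdeal_ne_top {C : DifferentialChain k n} (hC : C.IsIdealChain)
    (hinf : C.IsInfinite) : ∃ p, ∀ t, C.coeffIdeal (Pi.single p t) ≠ ⊤ := by
  by_contra hc
  push Not at hc
  choose t ht using hc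
  -- Beyond this bound every `α` has `α p ≥ t p` for some `p`, by pigeonhole; the factor `2` is the
  -- degree of the `y`'s.
  refine hinf ((Set.finite_Iic (2 * ∑ p, t p)).subset ?_)
  rintro m ⟨U, s, _, hsm⟩
  by_contra hm
  rw [Set.mem_Iic, not_le] at hm
  have htop (α : YMon n m) : C.coeffIdeal α.1 = ⊤ := by
    obtain ⟨p, hp⟩ : ∃ p, t p ≤ α.1 p := by
      by_contra hlt
      push Not at hlt
      have h1 : ∑ p, α.1 p ≤ ∑ p, t p := Finset.sum_le_sum fun p _ => (hlt p).le
      have h2 := α.2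
      omega
    refine top_le_iff.1 ((ht p).symm.le.trans (coeffIdeal_mono hC fun q => ?_))
    by_cases hq : q = p
    · subst hq
      rwa [Pi.single_eq_same]
    · rw [Pi.single_eq_of_ne hq]
      exact Nat.zero_le _
  have hI (f : SR k n m) : f ∈ C.I m := by
    rw [← Finset.univ_sum_single f]
    exact Submodule.sum_mem _ fun α _ => (C.single_mem_iff α _).2 (by rw [htop α]; trivial)
  refine hsm (funext fun x => ?_)
  -- Here `N_m = 0`, so every fraction vanishes.
  induction s m x using LocalizedModule.induction_on with | _ a r =>
  obtain ⟨f, rfl⟩ := Submodule.Quotient.mk_surjective _ a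
  rw [(Submodule.Quotient.mk_eq_zero _).2 (hI f), LocalizedModule.zero_mk]
  rfl

/-- The union of the increasing ideals along the ray is proper because `1` would already lie at a
finite stage. It is stable because differentiation moves stage `t` into stage `t + 1`, and stage `0`
is `I₀`. -/
theorem exists_ideal {C : DifferentialChain k n} (hC : C.IsIdealChain) (hinf : C.IsInfinite) :
    ∃ (p : YIdx n) (J : Ideal (S k n)), J.IsHomogeneous (grading k n) ∧ J ≠ ⊤ ∧ DerivLE p J J ∧
      DerivLE p C.baseIdeal J := by
  obtain ⟨p, hp⟩ := exists_coeffIdeal_ne_top hC hinf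
  have hmono : Monotone fun t => C.coeffIdeal (Pi.single p t) := fun a b hab =>
    coeffIdeal_mono hC (Pi.single_mono (f := fun _ => ℕ) p hab)
  have hmem (f : S k n) : f ∈ (⨆ t, C.coeffIdeal (Pi.single p t)) ↔
      ∃ t, f ∈ C.coeffIdeal (Pi.single p t) :=
    Submodule.mem_iSup_of_directed _ hmono.directed_le
  have hstep (t : ℕ) (f : S k n) (hf : f ∈ C.coeffIdeal (Pi.single p t)) :
      f ∈ (⨆ t, C.coeffIdeal (Pi.single p t)) ∧
      pderiv p.1.1 f ∈ (⨆ t, C.coeffIdeal (Pi.single p t)) ∧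
      pderiv p.1.2 f ∈ (⨆ t, C.coeffIdeal (Pi.single p t)) := by
    have h := derivLE_coeffIdeal hC _ p f hf
    rw [← Pi.single_add] at h
    simp only [hmem]
    exact ⟨⟨_, h.1⟩, ⟨_, h.2.1⟩, ⟨_, h.2.2⟩⟩
  refine ⟨p, ⨆ t, C.coeffIdeal (Pi.single p t),
    Ideal.IsHomogeneous.iSup fun t => C.isHomogeneous_coeffIdeal _, ?_, ?_, ?_⟩
  · intro htop
    obtain ⟨t, ht⟩ := (hmem 1).1 (by rw [htop]; trivial)
    exact hp t ((Ideal.eq_top_iff_one _).2 ht)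
  · intro f hf
    obtain ⟨t, ht⟩ := (hmem f).1 hf
    exact hstep t f ht
  · intro f hf
    rw [← coeffIdeal_zero, ← Pi.single_zero p] at hf
    exact hstep 0 f hf

end DifferentialChain

end GeomQuant

end

theorem mainTheorem7 {k : Type*} [Field k] [IsAlgClosed k] [CharZero k] (n : ℕ)
    (I₀ : Ideal (MvPolynomial (Fin (n + 1)) k))
    (hI₀ : I₀.IsHomogeneous (GeomQuant.grading k n)) :
    GeomQuant.AdmitsInfiniteGeometricQuantization I₀ ↔
      ∃ i j : Fin (n + 1), i < j ∧ ∃ J : Ideal (MvPolynomial (Fin (n + 1)) k),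
        J.IsHomogeneous (GeomQuant.grading k n) ∧ J ≠ ⊤ ∧
        (∀ f ∈ J, MvPolynomial.pderiv i f ∈ J ∧ MvPolynomial.pderiv j f ∈ J) ∧
        (∀ f ∈ I₀, f ∈ J ∧ MvPolynomial.pderiv i f ∈ J ∧ MvPolynomial.pderiv j f ∈ J) := by
  constructor
  · rintro ⟨C, rfl, hC, hinf⟩
    obtain ⟨p, J, hJ, hJt, hJJ, hIJ⟩ := GeomQuant.DifferentialChain.exists_ideal hC hinf
    exact ⟨p.1.1, p.1.2, p.2, J, hJ, hJt, fun f hf => (hJJ f hf).2, hIJ⟩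
  · rintro ⟨i, j, hij, J, hJ, hJt, hJJ, hIJ⟩
    exact GeomQuant.admits_of_ideal I₀ hI₀ ⟨(i, j), hij⟩ J hJ hJt
      (fun f hf => ⟨hf, hJJ f hf⟩) hIJ
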